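/- **Theorem.** Let $q\ge 4$ be a prime power and let $t$ and $r\ge 3$ be positive integers such that $2q^{r-3}<t\le q^{r-2}+q-1$. Let $\mathcal C$ be a projective $[q^{r-1}+q^{r-2}+t,\;r+1]_q$ code, every nonzero codeword of which has Hamming weight in $$\{\,q^{r-1},\; q^{r-1}+t-2q^{r-3},\; q^{r-1}+q^{r-2}+t\,\}.$$ Then $q$ is even, $t=q^{r-2}$, and $\mathcal C$ is a hypercylinder code. Here an $[n,k]_q$ code is a $k$-dimensional linear subspace of $\mathbb F_q^n$; it is *projective* if no two columns of a generator matrix (a matrix whose rows form a basis of the code) are proportional, a zero column being proportional to every column. A *hyperoval* in a plane $\sigma$ of order $q$ is a set of $q+2$ points of $\sigma$, no three of them collinear. A *hypercylinder* in $\mathrm{PG}(r,q)$ is a set $\bigcup_{P\in\mathcal H}\langle P,\pi\rangle\setminus\pi$, where $\pi$ is a subspace of projective dimension $r-3$, $\sigma$ is a plane complementary to $\pi$, and $\mathcal H$ is a hyperoval in $\sigma$. A *hypercylinder code* is the row space of a matrix over $\mathbb F_q$ whose columns are vector representatives of the points of a hypercylinder in $\mathrm{PG}(r,q)$, each point being represented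 by exactly one column. -/

import Mathlib

open scoped LinearAlgebra.Projectivization

namespace HypercylinderCode

variable {F : Type*} [Field F]

/-- The set of points of the projective space of `V` lying in the projective subspace determined
by the linear subspace `W` (of projective dimension `finrank W - 1`). -/
def pointsOf {V : Type*} [AddCommGroup V] [Module F V] (W : Submodule F V) : Set (ℙ F V) :=
  {P | P.submodule ≤ W}

/-- `H` is a hyperoval of the projective plane determined by the linear subspace `σ`: `σ` has
vector space dimension `3`, and `H` is a set of `q + 2` points of that plane, where `q = |F|`,
no three (distinct) of which lie on a common line. -/
structure IsHyperovalIn {V : Type*} [AddCommGroup V] [Module F V]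
    (σ : Submodule F V) (H : Set (ℙ F V)) : Prop where
  finrank_plane : Module.finrank F σ = 3
  subset_plane : H ⊆ pointsOf σ
  ncard_eq : H.ncard = Nat.card F + 2
  not_collinear : ∀ P ∈ H, ∀ Q ∈ H, ∀ R ∈ H, P ≠ Q → P ≠ R → Q ≠ R →
    ¬ ∃ L : Submodule F V, Module.finrank F L = 2 ∧
      P ∈ pointsOf L ∧ Q ∈ pointsOf L ∧ R ∈ pointsOf L

/-- The cone with vertex `π` and basis `S`: the union over `Q ∈ S` of the spans `⟨Q, π⟩`. -/
def cone {V : Type*} [AddCommGroup V] [Module F V]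
    (π : Submodule F V) (S : Set (ℙ F V)) : Set (ℙ F V) :=
  ⋃ Q ∈ S, pointsOf (Q.submodule ⊔ π)

/-- A hypercylinder of `PG(r, q)`: a cone minus its vertex `π`, where `π` is a subspace of
projective dimension `r - 3` (vector space dimension `r - 2`) and the basis of the cone is a
hyperoval in a plane `σ` complementary to `π`. -/
def IsHypercylinder (r : ℕ) (S : Set (ℙ F (Fin (r + 1) → F))) : Prop :=
  ∃ (π σ : Submodule F (Fin (r + 1) → F)) (H : Set (ℙ F (Fin (r + 1) → F))),
    IsCompl π σ ∧ Module.finrank F π + 2 = r ∧ IsHyperovalIn σ H ∧ S = cone π H \ pointsOf π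

/-- `G` is a generator matrix of the linear code `C`: its rows form a basis of `C`. -/
def IsGeneratorMatrix {k n : ℕ} (G : Matrix (Fin k) (Fin n) F)
    (C : Submodule F (Fin n → F)) : Prop :=
  LinearIndependent F G.row ∧ Submodule.span F (Set.range G.row) = C

/-- A linear code is projective if it has a generator matrix no two columns of which are
proportional (a zero column counts as proportional to every column). -/
def IsProjectiveCode {n : ℕ} (C : Submodule F (Fin n → F)) : Prop :=
  ∃ (k : ℕ) (G : Matrix (Fin k) (Fin n) F), IsGeneratorMatrix G C ∧
    ∀ i j : Fin n, i ≠ j → ∀ a : F, G.col i ≠ a • G.col j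

/-- `C` is a code associated with the point set `S` of the projective space of `F ^ k`: it is the
space generated by the rows of a matrix whose columns are representatives of the points of `S`,
each point being represented by exactly one column. -/
def IsCodeAssociatedWith {k n : ℕ} (C : Submodule F (Fin n → F))
    (S : Set (ℙ F (Fin k → F))) : Prop :=
  ∃ (G : Matrix (Fin k) (Fin n) F) (hG : ∀ j, G.col j ≠ 0),
    Set.BijOn (fun j => Projectivization.mk F (G.col j) (hG j)) Set.univ S ∧
    C = Submodule.span F (Set.range G.row)

/-- A hypercylinder code (of dimension `r + 1`): a code associated with a hypercylinder of
`PG(r, q)`. -/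
def IsHypercylinderCode {n : ℕ} (r : ℕ) (C : Submodule F (Fin n → F)) : Prop :=
  ∃ S : Set (ℙ F (Fin (r + 1) → F)), IsHypercylinder r S ∧ IsCodeAssociatedWith C S

end HypercylinderCode

/-! Put r = m + 3 and t = 2q^m + s, and regard the columns of a generator matrix as n points of
PG(r, q). The zeros of a codeword are the columns lying in a hyperplane, so every hyperplane
contains 0, a = q^(m+1) + 2q^m or b = a + s columns. The argument lives in the dual space `U`:
hyperplanes are its nonzero vectors, columns are functionals on it, and a vector has top level when
b functionals vanish at it.

On a subspace where at least one functional vanishes only the levels a and b occur, so double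
counting relates the number of top vectors there to the number of functionals vanishing on it. With
the bounds on t and q being a prime power, this yields exactly q + 1 top points in each `ker (e i)`
(`levelCount_ker`), and these meet every hyperplane of `ker (e i)` (`levelCount_pos`). A blocking
set of q + 1 points is a line (`exists_line_of_blocking`). The resulting lines meet pairwise and
have no common point, so they lie in a plane T (`exists_plane`), on which only the levels 0 and b
occur. Counting on a line of T through a point of level 0 gives b ∣ q^(m+2); since q^(m+1) < b <
3q^(m+1), it follows that b = 2q^(m+1), so q is even and t = q^(m+1) (`even_and_eq`).

The annihilator π of T is the vertex of the cone. The span of π and a column contains q^(m+1)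
columns, which are all its points outside π. Projecting from π leaves q + 2 points, no three
collinear because a hyperplane holds at most 2q^(m+1) columns (`exists_cone`). -/

namespace HypercylinderCode

open Module
open scoped Classical

set_option linter.unusedSectionVars false

/-! ### Double counting of zeros of a family of functionals -/

section Counting

variable {F : Type*} [Field F] {U : Type*} [AddCommGroup U] [Module F U]

/-- If the functional `f` does not vanish on `D`, its kernel on `D` has codimension one. -/
lemma finrank_inf_ker_add_one [FiniteDimensional F U] {D : Submodule F U} {f : Dual F U}
    (h : ¬ D ≤ LinearMap.ker f) : finrank F ↥(D ⊓ LinearMap.ker f) + 1 = finrank F D := by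
  have hf : f ≠ 0 := by
    rintro rfl
    exact h fun u _ => by simp
  have h1 := Dual.finrank_ker_add_one_of_ne_zero hf
  have h2 := Submodule.finrank_sup_add_finrank_inf_eq D (LinearMap.ker f)
  have h3 : finrank F (LinearMap.ker f) < finrank F ↥(D ⊔ LinearMap.ker f) := by
    apply Submodule.finrank_lt_finrank_of_lt
    refine lt_of_le_of_ne le_sup_right fun he => h ?_
    rw [he]
    exact le_sup_left
  have h4 := Submodule.finrank_le (D ⊔ LinearMap.ker f)
  omega

lemma exists_le_finrank_eq [FiniteDimensional F U] (Y : Submodule F U) {k : ℕ}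
    (hk : k ≤ finrank F Y) : ∃ D ≤ Y, finrank F D = k := by
  induction hd : finrank F Y - k generalizing Y with
  | zero => exact ⟨Y, le_rfl, by omega⟩
  | succ d ih =>
    have hY : Y ≠ ⊥ := by
      rintro rfl
      simp at hd
    obtain ⟨y, hy, hy0⟩ := Submodule.exists_mem_ne_zero_of_ne_bot hY
    obtain ⟨f, hf, -⟩ := Submodule.exists_le_ker_of_notMem (p := (⊥ : Submodule F U)) (v := y)
      (by simpa using hy0)
    have hn : ¬ Y ≤ LinearMap.ker f := fun h => hf (h hy)
    have := finrank_inf_ker_add_one hn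
    obtain ⟨D, hD, hD'⟩ := ih (Y ⊓ LinearMap.ker f) (by omega) (by omega)
    exact ⟨D, hD.trans inf_le_left, hD'⟩

lemma finrank_span_pair_eq_two {x y : U} (hx : x ≠ 0) (hy : y ∉ Submodule.span F {x}) :
    finrank F (Submodule.span F {x, y}) = 2 := by
  have h : LinearIndependent F ![x, y] := by
    rw [LinearIndependent.pair_iff' hx]
    rintro a rfl
    exact hy (Submodule.smul_mem _ _ (Submodule.mem_span_singleton_self x))
  have := finrank_span_eq_card h
  rwa [Matrix.range_cons, Matrix.range_cons, Matrix.range_empty, Set.union_empty,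
    Set.singleton_union, Fintype.card_fin] at this

lemma finrank_le_one_of_forall_mem_span {L : Submodule F U} {x : U}
    (h : ∀ y ∈ L, y ∈ Submodule.span F {x}) : finrank F L ≤ 1 :=
  (Submodule.finrank_mono h).trans ((finrank_span_le_card {x}).trans (by simp))

variable [Fintype F] [Fintype U]

lemma card_filter_mem (D : Submodule F U) :
    (Finset.univ.filter (· ∈ D)).card = Fintype.card F ^ finrank F D := by
  rw [← Module.card_eq_pow_finrank (K := F) (V := D), Fintype.card_subtype]

lemma card_filter_mem_ker {D : Submodule F U} {f : Dual F U} {j : ℕ} (hD : finrank F D = j + 1) :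
    (Finset.univ.filter (fun u => u ∈ D ∧ f u = 0)).card =
      if D ≤ LinearMap.ker f then Fintype.card F ^ (j + 1) else Fintype.card F ^ j := by
  have h : (Finset.univ.filter (fun u => u ∈ D ∧ f u = 0)) =
      Finset.univ.filter (· ∈ D ⊓ LinearMap.ker f) := by
    ext u; simp
  rw [h, card_filter_mem]
  split_ifs with hf
  · rw [inf_eq_left.mpr hf, hD]
  · have := finrank_inf_ker_add_one hf
    congr 1
    omega

/-- The set of nonzero multiples of a vector. -/
noncomputable def multiples (F : Type*) [Field F] [Fintype F] [Module F U] (x : U) : Finset U :=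
  Finset.univ.image fun a : Fˣ => a • x

lemma mem_multiples {x y : U} : y ∈ multiples F x ↔ ∃ a : Fˣ, a • x = y := by
  simp [multiples]

lemma card_multiples {x : U} (hx : x ≠ 0) : (multiples F x).card = Fintype.card F - 1 := by
  rw [multiples, Finset.card_image_of_injective, Finset.card_univ, Fintype.card_units]
  intro a b hab
  have : (a : F) • x = (b : F) • x := hab
  exact Units.ext (smul_left_injective F hx this)

/-- A set of nonzero vectors closed under nonzero scalars has size divisible by `q - 1`. -/
lemma card_sub_one_dvd_card {S : Finset U} (h0 : ∀ u ∈ S, u ≠ 0)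
    (hS : ∀ u ∈ S, ∀ a : Fˣ, a • u ∈ S) : Fintype.card F - 1 ∣ S.card := by
  rw [Finset.card_eq_sum_card_image (fun u : U => Submodule.span F {u}) S]
  refine Finset.dvd_sum fun b hb => ?_
  obtain ⟨x, hx, rfl⟩ := Finset.mem_image.mp hb
  rw [← card_multiples (F := F) (h0 x hx)]
  refine dvd_of_eq (congrArg _ ?_)
  ext y
  simp only [mem_multiples, Finset.mem_filter]
  constructor
  · rintro ⟨a, rfl⟩
    exact ⟨hS x hx a, (Submodule.span_singleton_eq_span_singleton.mpr ⟨a, rfl⟩).symm⟩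
  · rintro ⟨-, h⟩
    exact Submodule.span_singleton_eq_span_singleton.mp h.symm

variable {ι : Type*} [Fintype ι] (e : ι → Dual F U)

/-- The number of functionals of the family `e` vanishing at `u`. -/
noncomputable def zeroCount (u : U) : ℕ := (Finset.univ.filter fun i => e i u = 0).card

/-- The number of functionals of the family `e` vanishing on `D`. -/
noncomputable def commonZeroCount (D : Submodule F U) : ℕ :=
  (Finset.univ.filter fun i => D ≤ LinearMap.ker (e i)).card

/-- The number of nonzero vectors of `D` at which exactly `b` functionals vanish. -/
noncomputable def levelCount (b : ℕ) (D : Submodule F U) : ℕ :=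
  (Finset.univ.filter fun u => u ∈ D ∧ u ≠ 0 ∧ zeroCount e u = b).card

lemma zeroCount_zero : zeroCount e 0 = Fintype.card ι := by
  simp [zeroCount]

lemma zeroCount_smul (a : Fˣ) (u : U) : zeroCount e (a • u) = zeroCount e u := by
  unfold zeroCount
  congr 1
  ext i
  simp [Units.smul_def]

lemma commonZeroCount_le_zeroCount {D : Submodule F U} {u : U} (hu : u ∈ D) :
    commonZeroCount e D ≤ zeroCount e u := by
  refine Finset.card_le_card fun i hi => ?_
  simp only [Finset.mem_filter, Finset.mem_univ, true_and] at hi ⊢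
  exact hi hu

lemma commonZeroCount_pos {D : Submodule F U} {i : ι} (hi : D ≤ LinearMap.ker (e i)) :
    0 < commonZeroCount e D :=
  Finset.card_pos.mpr ⟨i, by simpa using hi⟩

lemma levelCount_mono (b : ℕ) {D D' : Submodule F U} (h : D ≤ D') :
    levelCount e b D ≤ levelCount e b D' := by
  refine Finset.card_le_card fun u hu => ?_
  simp only [Finset.mem_filter, Finset.mem_univ, true_and] at hu ⊢
  exact ⟨h hu.1, hu.2⟩

/-- Levels are invariant under nonzero scalars, so vectors are counted q − 1 per projective point;
this factor is later cancelled from the counting equations. -/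
lemma card_sub_one_dvd_levelCount (b : ℕ) (D : Submodule F U) :
    Fintype.card F - 1 ∣ levelCount e b D := by
  refine card_sub_one_dvd_card (F := F) (fun u hu => (Finset.mem_filter.mp hu).2.2.1)
    fun u hu a => ?_
  simp only [Finset.mem_filter, Finset.mem_univ, true_and] at hu ⊢
  refine ⟨D.smul_of_tower_mem a hu.1, ?_, ?_⟩
  · simpa [smul_eq_zero_iff_eq] using hu.2.1
  · rw [zeroCount_smul, hu.2.2]

/-- Double counting of the zeros of the vectors of `D`. -/
lemma sum_zeroCount {D : Submodule F U} {j : ℕ} (hD : finrank F D = j + 1) :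
    ((∑ u ∈ Finset.univ.filter (· ∈ D), zeroCount e u : ℕ) : ℤ) =
      (Fintype.card F : ℤ) ^ j *
        (Fintype.card ι + ((Fintype.card F : ℤ) - 1) * commonZeroCount e D) := by
  have h1 : (∑ u ∈ Finset.univ.filter (· ∈ D), zeroCount e u) =
      ∑ i, (Finset.univ.filter (fun u => u ∈ D ∧ e i u = 0)).card := by
    simp only [zeroCount, Finset.card_filter]
    rw [Finset.sum_comm]
    refine Finset.sum_congr rfl fun i _ => ?_
    rw [Finset.sum_filter]
    refine Finset.sum_congr rfl fun u _ => ?_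
    by_cases hu : u ∈ D <;> simp [hu]
  rw [h1]
  simp only [card_filter_mem_ker hD]
  have h2 : ∀ i, ((if D ≤ LinearMap.ker (e i) then Fintype.card F ^ (j + 1)
      else Fintype.card F ^ j : ℕ) : ℤ) = (Fintype.card F : ℤ) ^ j *
        (1 + ((Fintype.card F : ℤ) - 1) * (if D ≤ LinearMap.ker (e i) then 1 else 0 : ℕ)) := by
    intro i
    split_ifs <;> push_cast <;> ring
  rw [Nat.cast_sum, Finset.sum_congr rfl fun i _ => h2 i, ← Finset.mul_sum,
    Finset.sum_add_distrib, ← Finset.mul_sum, commonZeroCount, Finset.card_filter]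
  simp

/-- Double counting when the nonzero vectors of `D` take only two values. -/
lemma sum_zeroCount_of_two_values {D : Submodule F U} {j a s : ℕ} (hs : s ≠ 0)
    (hD : finrank F D = j + 1)
    (h : ∀ u ∈ D, u ≠ 0 → zeroCount e u = a ∨ zeroCount e u = a + s) :
    (Fintype.card F : ℤ) ^ j *
        (Fintype.card ι + ((Fintype.card F : ℤ) - 1) * commonZeroCount e D) =
      Fintype.card ι + a * ((Fintype.card F : ℤ) ^ (j + 1) - 1) + s * levelCount e (a + s) D := by
  rw [← sum_zeroCount e hD]
  have h0 : (0 : U) ∈ Finset.univ.filter (· ∈ D) := by simp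
  have h1 : ∀ u ∈ (Finset.univ.filter (· ∈ D)).erase 0, zeroCount e u =
      a + s * (if zeroCount e u = a + s then 1 else 0) := by
    intro u hu
    simp only [Finset.mem_erase, Finset.mem_filter, Finset.mem_univ, true_and] at hu
    rcases h u hu.2 hu.1 with h | h
    · rw [if_neg (by omega)]; omega
    · rw [if_pos h]; omega
  have h2 : levelCount e (a + s) D =
      (((Finset.univ.filter (· ∈ D)).erase 0).filter fun u => zeroCount e u = a + s).card := by
    rw [levelCount]
    congr 1
    ext u
    simp only [Finset.mem_erase, Finset.mem_filter, Finset.mem_univ, true_and]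
    tauto
  have h3 : (((Finset.univ.filter (· ∈ D)).erase 0).card : ℤ) =
      (Fintype.card F : ℤ) ^ (j + 1) - 1 := by
    rw [Finset.cast_card_erase_of_mem h0, card_filter_mem, hD]
    push_cast; ring
  rw [← Finset.add_sum_erase _ _ h0, zeroCount_zero, Finset.sum_congr rfl h1,
    Finset.sum_add_distrib, ← Finset.mul_sum, ← Finset.card_filter, ← h2]
  push_cast
  rw [Finset.sum_const, nsmul_eq_mul, ← h3]
  ring

end Counting

/-! ### Blocking sets and averaging over hyperplanes -/

section Blocking

variable {F : Type*} [Field F] [Fintype F] {X : Type*} [AddCommGroup X] [Module F X] [Fintype X]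

lemma zeroCount_eval (S : Finset X) (f : Dual F X) :
    zeroCount (fun u : S => Dual.eval F X u) f = (S.filter fun u => f u = 0).card := by
  simp only [zeroCount, Dual.eval_apply]
  refine Finset.card_bij (fun u _ => (u : X)) (fun u hu => ?_) (fun u _ v _ h => Subtype.ext h)
    fun u hu => ?_
  · exact Finset.mem_filter.mpr ⟨u.2, (Finset.mem_filter.mp hu).2⟩
  · obtain ⟨h1, h2⟩ := Finset.mem_filter.mp hu
    exact ⟨⟨u, h1⟩, Finset.mem_filter.mpr ⟨Finset.mem_univ _, h2⟩, rfl⟩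

lemma multiples_subset {S : Finset X} (hS : ∀ u ∈ S, ∀ a : Fˣ, a • u ∈ S) {x : X} (hx : x ∈ S) :
    multiples F x ⊆ S := by
  intro y hy
  obtain ⟨a, rfl⟩ := mem_multiples.mp hy
  exact hS x hx a

lemma multiples_subset_ker {f : Dual F X} {x y : X} (hx : f x = 0) (hy : y ∈ multiples F x) :
    f y = 0 := by
  obtain ⟨a, rfl⟩ := mem_multiples.mp hy
  simp [Units.smul_def, hx]

lemma disjoint_multiples {x y : X} (hy : y ∉ Submodule.span F {x}) :
    Disjoint (multiples F x) (multiples F y) := by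
  rw [Finset.disjoint_left]
  intro z hx hz
  obtain ⟨a, rfl⟩ := mem_multiples.mp hx
  obtain ⟨b, hb⟩ := mem_multiples.mp hz
  apply hy
  rw [Submodule.mem_span_singleton]
  refine ⟨((b⁻¹ * a : Fˣ) : F), ?_⟩
  rw [← Units.smul_def, mul_smul, ← hb, inv_smul_smul]

lemma exists_smul_eq_of_mem_span_singleton {x y : X} (hy : y ∈ Submodule.span F {x})
    (hy0 : y ≠ 0) : ∃ a : Fˣ, a • x = y := by
  obtain ⟨c, rfl⟩ := Submodule.mem_span_singleton.mp hy
  have hc : c ≠ 0 := by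
    rintro rfl
    simp at hy0
  exact ⟨Units.mk0 c hc, rfl⟩

/-- A set of `q + 1` points meeting every hyperplane is a line. -/
theorem exists_line_of_blocking {S : Finset X} (h0 : ∀ u ∈ S, u ≠ 0)
    (hS : ∀ u ∈ S, ∀ a : Fˣ, a • u ∈ S) (hcard : S.card = Fintype.card F ^ 2 - 1)
    (hblock : ∀ f : Dual F X, ∃ u ∈ S, f u = 0) :
    ∃ L : Submodule F X, finrank F L = 2 ∧ ∀ u, u ≠ 0 → (u ∈ L ↔ u ∈ S) := by
  have hq : 1 < Fintype.card F := Fintype.one_lt_card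
  set q := Fintype.card F with hqdef
  have hfin : Finite (Dual F X) := Module.finite_of_finite F
  have : Fintype (Dual F X) := Fintype.ofFinite _
  obtain ⟨x, hx, -⟩ := hblock 0
  obtain ⟨y, hy, hyx⟩ : ∃ y ∈ S, y ∉ Submodule.span F {x} := by
    by_contra! hcon
    have h1 : S ⊆ multiples F x := fun u hu =>
      mem_multiples.mpr (exists_smul_eq_of_mem_span_singleton (hcon u hu) (h0 u hu))
    have h2 := Finset.card_le_card h1
    rw [card_multiples (h0 x hx), hcard, ← hqdef] at h2
    have : q * 2 ≤ q ^ 2 := by rw [pow_two]; exact Nat.mul_le_mul_left _ hq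
    omega
  set L := Submodule.span F {x, y} with hL
  have hL2 : finrank F L = 2 := finrank_span_pair_eq_two (h0 x hx) hyx
  have hsub : ∀ w ∈ L, w ≠ 0 → w ∈ S := by
    intro w hwL hw0
    -- Count zeros in S of the functionals killing w. Blocking gives each at least q − 1 zeros, and
    -- 2(q − 1) if it kills all of L. Since w ∉ S, no vector of S is killed by all of `D₁`, so the
    -- true total equals the sum of these bounds; but the zero functional strictly exceeds its
    -- share.
    by_contra hwS
    obtain ⟨j, hj⟩ : ∃ j, finrank F X = j + 2 := by
      have := Submodule.finrank_le L
      exact ⟨finrank F X - 2, by omega⟩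
    set D₁ := (Submodule.span F {w}).dualAnnihilator with hD₁
    set D₂ := L.dualAnnihilator with hD₂
    have hD₂₁ : D₂ ≤ D₁ := Submodule.dualAnnihilator_anti
      ((Submodule.span_singleton_le_iff_mem _ _).mpr hwL)
    have hf₁ : finrank F D₁ = j + 1 := by
      have : finrank F (Submodule.span F {w}) + finrank F D₁ = finrank F X :=
        Subspace.finrank_add_finrank_dualAnnihilator_eq _
      rw [finrank_span_singleton hw0] at this
      omega
    have hf₂ : finrank F D₂ = j := by
      have : finrank F L + finrank F D₂ = finrank F X :=
        Subspace.finrank_add_finrank_dualAnnihilator_eq _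
      omega
    have hZ : commonZeroCount (fun u : S => Dual.eval F X u) D₁ = 0 := by
      rw [commonZeroCount, Finset.card_eq_zero, Finset.filter_eq_empty_iff]
      rintro ⟨u, hu⟩ - hle
      have h1 : u ∈ D₁.dualCoannihilator := by
        rw [Submodule.mem_dualCoannihilator]
        intro f hf
        simpa using hle hf
      rw [hD₁, Subspace.dualAnnihilator_dualCoannihilator_eq] at h1
      obtain ⟨a, rfl⟩ := exists_smul_eq_of_mem_span_singleton h1 (h0 u hu)
      exact hwS (by simpa using hS _ hu a⁻¹)
    have hsum := sum_zeroCount (fun u : S => Dual.eval F X u) hf₁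
    rw [hZ] at hsum
    simp only [zeroCount_eval] at hsum
    have hlt : ∑ f ∈ Finset.univ.filter (· ∈ D₁), ((q - 1) * (1 + if f ∈ D₂ then 1 else 0)) <
        ∑ f ∈ Finset.univ.filter (· ∈ D₁), (S.filter fun u => f u = 0).card := by
      refine Finset.sum_lt_sum (fun f _ => ?_) ⟨0, by simp, ?_⟩
      · split_ifs with hf
        · have hfx : f x = 0 := (Submodule.mem_dualAnnihilator f).mp hf x
            (Submodule.subset_span (by simp))
          have hfy : f y = 0 := (Submodule.mem_dualAnnihilator f).mp hf y
            (Submodule.subset_span (by simp))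
          have h1 : multiples F x ∪ multiples F y ⊆ S.filter fun u => f u = 0 := by
            intro z hz
            rcases Finset.mem_union.mp hz with hz | hz
            · exact Finset.mem_filter.mpr ⟨multiples_subset hS hx hz, multiples_subset_ker hfx hz⟩
            · exact Finset.mem_filter.mpr ⟨multiples_subset hS hy hz, multiples_subset_ker hfy hz⟩
          have h2 := Finset.card_le_card h1
          rw [Finset.card_union_of_disjoint (disjoint_multiples hyx), card_multiples (h0 x hx),
            card_multiples (h0 y hy)] at h2
          omega
        · obtain ⟨u, hu, hfu⟩ := hblock f
          have h1 : multiples F u ⊆ S.filter fun u => f u = 0 := fun z hz =>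
            Finset.mem_filter.mpr ⟨multiples_subset hS hu hz, multiples_subset_ker hfu hz⟩
          have h2 := Finset.card_le_card h1
          rw [card_multiples (h0 u hu)] at h2
          omega
      · simp only [LinearMap.zero_apply, Finset.filter_true, hcard, zero_mem, if_true]
        obtain ⟨c, hc⟩ : ∃ c, q = c + 2 := ⟨q - 2, by omega⟩
        rw [hc]
        have : (c + 2) ^ 2 - 1 = c ^ 2 + 4 * c + 3 := by
          have : (c + 2) ^ 2 = c ^ 2 + 4 * c + 3 + 1 := by ring
          omega
        rw [this, show c + 2 - 1 = c + 1 by omega]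
        nlinarith
    have hlow : ∑ f ∈ Finset.univ.filter (· ∈ D₁), ((q - 1) * (1 + if f ∈ D₂ then 1 else 0)) =
        (q - 1) * (q ^ (j + 1) + q ^ j) := by
      rw [← Finset.mul_sum, Finset.sum_add_distrib, ← Finset.card_eq_sum_ones, card_filter_mem,
        hf₁, ← Finset.card_filter, Finset.filter_filter]
      have : (Finset.univ.filter fun f => f ∈ D₁ ∧ f ∈ D₂) = Finset.univ.filter (· ∈ D₂) := by
        ext f
        simp only [Finset.mem_filter, Finset.mem_univ, true_and]
        exact ⟨fun h => h.2, fun h => ⟨hD₂₁ h, h⟩⟩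
      rw [this, card_filter_mem, hf₂]
    rw [hlow] at hlt
    have hlt' : (((q - 1) * (q ^ (j + 1) + q ^ j) : ℕ) : ℤ) <
        ((∑ f ∈ Finset.univ.filter (· ∈ D₁), (S.filter fun u => f u = 0).card : ℕ) : ℤ) := by
      exact_mod_cast hlt
    rw [hsum, Fintype.card_coe, hcard] at hlt'
    have hq1 : 1 ≤ q ^ 2 := Nat.one_le_pow _ _ (by omega)
    push_cast [Nat.cast_sub hq1, Nat.cast_sub hq.le] at hlt'
    refine absurd hlt' (not_lt_of_ge (le_of_eq ?_))
    ring
  refine ⟨L, hL2, fun u hu => ⟨fun h => hsub u h hu, ?_⟩⟩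
  have h1 : (Finset.univ.filter (· ∈ L)).erase 0 ⊆ S := by
    intro w hw
    simp only [Finset.mem_erase, Finset.mem_filter, Finset.mem_univ, true_and] at hw
    exact hsub w hw.2 hw.1
  have h2 := Finset.eq_of_subset_of_card_le h1 (by
    rw [Finset.card_erase_of_mem (by simp), card_filter_mem, hL2, hcard])
  intro huS
  rw [← h2] at huS
  simpa using (Finset.mem_erase.mp huS).2

/-- Some hyperplane contains at most a `1 / q` fraction of a given set of nonzero vectors. -/
lemma exists_hyperplane_card_mul_le {S : Finset X} (h0 : ∀ u ∈ S, u ≠ 0)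
    (hX : 0 < finrank F X) :
    ∃ f : Dual F X, f ≠ 0 ∧ Fintype.card F * (S.filter fun u => f u = 0).card ≤ S.card := by
  have hq : 1 < Fintype.card F := Fintype.one_lt_card
  have hfin : Finite (Dual F X) := Module.finite_of_finite F
  have : Fintype (Dual F X) := Fintype.ofFinite _
  obtain ⟨j, hj⟩ : ∃ j, finrank F X = j + 1 := ⟨finrank F X - 1, by omega⟩
  have hT : finrank F (⊤ : Submodule F (Dual F X)) = j + 1 := by
    rw [finrank_top, Subspace.dual_finrank_eq, hj]
  have hZ : commonZeroCount (fun u : S => Dual.eval F X u) ⊤ = 0 := by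
    rw [commonZeroCount, Finset.card_eq_zero, Finset.filter_eq_empty_iff]
    rintro ⟨u, hu⟩ - hle
    exact h0 u hu ((Module.forall_dual_apply_eq_zero_iff F u).mp fun f => by
      simpa using hle (Submodule.mem_top (x := f)))
  have hsum := sum_zeroCount (fun u : S => Dual.eval F X u) hT
  rw [hZ] at hsum
  simp only [zeroCount_eval, Submodule.mem_top, Finset.filter_true, Fintype.card_coe] at hsum
  have hcardD : (Fintype.card (Dual F X) : ℤ) = (Fintype.card F : ℤ) ^ (j + 1) := by
    rw [Module.card_eq_pow_finrank (K := F), Subspace.dual_finrank_eq, hj]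
    push_cast; rfl
  -- The zero functional takes |S| of the total q^j |S|, so the others average (q^j − 1)|S| /
  -- (q^(j+1) − 1), which is at most |S| / q.
  by_contra! hcon
  have h1 : ∑ f ∈ (Finset.univ : Finset (Dual F X)).erase 0, (S.card + 1) ≤
      ∑ f ∈ (Finset.univ : Finset (Dual F X)).erase 0,
        Fintype.card F * (S.filter fun u => f u = 0).card :=
    Finset.sum_le_sum fun f hf => hcon f (Finset.mem_erase.mp hf).1
  rw [← Finset.mul_sum, Finset.sum_const, Finset.card_erase_of_mem (Finset.mem_univ _),
    Finset.card_univ, smul_eq_mul] at h1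
  rw [← Finset.add_sum_erase _ _ (Finset.mem_univ (0 : Dual F X))] at hsum
  simp only [LinearMap.zero_apply, Finset.filter_true] at hsum
  have h2 : ((Fintype.card (Dual F X) - 1 : ℕ) : ℤ) = (Fintype.card F : ℤ) ^ (j + 1) - 1 := by
    rw [Nat.cast_sub Fintype.card_pos, hcardD]; rfl
  zify at h1
  rw [h2] at h1
  push_cast at hsum
  have h3 : (0 : ℤ) < (Fintype.card F : ℤ) ^ (j + 1) - 1 := by
    have : 1 < (Fintype.card F : ℤ) ^ (j + 1) := one_lt_pow₀ (by exact_mod_cast hq) (by omega)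
    omega
  have hq' : (1 : ℤ) < Fintype.card F := by exact_mod_cast hq
  have h4 : (0 : ℤ) ≤ S.card := by positivity
  rw [pow_succ] at h1 h3
  nlinarith [mul_nonneg h4 (sub_nonneg.mpr hq'.le)]

end Blocking

/-! ### Families with three intersection numbers: basic equations -/

section ThreeCharacter

/-- A family of pairwise non-proportional functionals for which the number of functionals
vanishing at a nonzero vector takes only the values of the main theorem, where `r = m + 3` and
`t = 2 * q ^ m + s`. -/
structure IsThreeCharacter {F : Type*} [Field F] [Fintype F] {U : Type*} [AddCommGroup U]
    [Module F U] {ι : Type*} [Fintype ι] (e : ι → Dual F U) (q m s : ℕ) : Prop where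
  card_field : Fintype.card F = q
  four_le : 4 ≤ q
  finrank_eq : finrank F U = m + 4
  card_index : Fintype.card ι = q ^ (m + 2) + q ^ (m + 1) + 2 * q ^ m + s
  pos : 0 < s
  le : s + 2 * q ^ m + 1 ≤ q ^ (m + 1) + q
  values : ∀ u ≠ 0, zeroCount e u = 0 ∨ zeroCount e u = q ^ (m + 1) + 2 * q ^ m ∨
    zeroCount e u = q ^ (m + 1) + 2 * q ^ m + s
  ne_zero : ∀ i, e i ≠ 0
  eq_of_ker_le : ∀ i j, LinearMap.ker (e i) ≤ LinearMap.ker (e j) → i = j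

variable {F : Type*} [Field F] [Fintype F] {U : Type*} [AddCommGroup U] [Module F U] [Fintype U]
  {ι : Type*} [Fintype ι] {e : ι → Dual F U} {q m s : ℕ}

/-- With q = p^k, split q² as p^i ∣ s and p^j ∣ E with i + j = 2k. If i < k, then p^(k+1) ∣ E, which
makes E at least 2q. -/
lemma dvd_of_sq_dvd_mul {s E : ℕ} (hq : IsPrimePow q) (h : q ^ 2 ∣ s * E) (hE : 0 < E)
    (hEq : E < 2 * q) : q ∣ s := by
  obtain ⟨p, k, hp, hk, rfl⟩ := hq
  have hp' : p.Prime := hp.nat_prime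
  obtain ⟨d₁, d₂, h1, h2, h3⟩ := exists_dvd_and_dvd_of_dvd_mul h
  rw [← pow_mul] at h3
  obtain ⟨i, hi, rfl⟩ := (Nat.dvd_prime_pow hp').mp ⟨d₂, h3⟩
  obtain ⟨j, hj, rfl⟩ := (Nat.dvd_prime_pow hp').mp ⟨p ^ i, h3.trans (mul_comm _ _)⟩
  rw [← pow_add] at h3
  have hij := Nat.pow_right_injective hp'.two_le h3
  by_cases hki : k ≤ i
  · exact (pow_dvd_pow p hki).trans h1
  · exfalso
    have h4 : p ^ (k + 1) ∣ E := (pow_dvd_pow p (by omega)).trans h2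
    have h5 := Nat.le_of_dvd hE h4
    have h6 : 2 * p ^ k ≤ p ^ (k + 1) := by
      rw [pow_succ, mul_comm]
      exact Nat.mul_le_mul_left _ hp'.two_le
    omega

namespace IsThreeCharacter

/-- Double counting of pairs of a functional and a vector of level b that it kills. The hypothesis
on b excludes the zero vector, whose level is `Fintype.card ι`. -/
lemma sum_levelCount_ker (e : ι → Dual F U) {b : ℕ} (hb : b ≠ Fintype.card ι) :
    ∑ i, levelCount e b (LinearMap.ker (e i)) = b * levelCount e b ⊤ := by
  have hne : ∀ u, zeroCount e u = b → u ≠ 0 := by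
    rintro u hu rfl
    exact hb (hu.symm.trans (zeroCount_zero e))
  have h1 : b * levelCount e b ⊤ =
      ∑ u ∈ Finset.univ.filter (fun u => zeroCount e u = b), zeroCount e u := by
    rw [Finset.sum_congr rfl fun u hu => (Finset.mem_filter.mp hu).2, Finset.sum_const,
      smul_eq_mul, mul_comm, levelCount]
    congr 2
    ext u
    simp only [Finset.mem_filter, Finset.mem_univ, true_and, Submodule.mem_top]
    exact ⟨fun hu => hu.2, fun hu => ⟨hne u hu, hu⟩⟩
  rw [h1]
  simp only [levelCount, Finset.card_filter]
  rw [Finset.sum_comm, Finset.sum_filter]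
  refine Finset.sum_congr rfl fun u _ => ?_
  split_ifs with hu
  · conv_rhs => rw [zeroCount, Finset.card_filter]
    refine Finset.sum_congr rfl fun i _ => ?_
    simp [hu, hne u hu]
  · simp [hu]

variable (h : IsThreeCharacter e q m s)
include h

lemma isPrimePow : IsPrimePow q := h.card_field ▸ Fintype.isPrimePow_card_of_field

lemma values_of_commonZeroCount_pos {D : Submodule F U} (hZ : 0 < commonZeroCount e D) {u : U}
    (hu : u ∈ D) (hu0 : u ≠ 0) : zeroCount e u = q ^ (m + 1) + 2 * q ^ m ∨
      zeroCount e u = q ^ (m + 1) + 2 * q ^ m + s := by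
  have := commonZeroCount_le_zeroCount e hu
  rcases h.values u hu0 with h1 | h1 | h1
  · omega
  · exact Or.inl h1
  · exact Or.inr h1

/-- The number of vectors at which many functionals vanish, in a subspace on which at least one
functional vanishes. -/
lemma levelCount_eq {D : Submodule F U} {j : ℕ} (hD : finrank F D = j + 1)
    (hZ : 0 < commonZeroCount e D) :
    ((q : ℤ) - 1) * q ^ j * commonZeroCount e D +
        s * (q ^ j - 1 - levelCount e (q ^ (m + 1) + 2 * q ^ m + s) D) =
      (q - 1) * q ^ m * (q + 2) + q ^ m * (q - 2) * (q ^ j - 1) := by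
  have h1 := sum_zeroCount_of_two_values e h.pos.ne' hD
    fun u hu hu0 => h.values_of_commonZeroCount_pos hZ hu hu0
  rw [h.card_field, h.card_index] at h1
  push_cast at h1
  linear_combination h1

lemma exists_levelCount_eq (b : ℕ) (D : Submodule F U) :
    ∃ B : ℕ, (levelCount e b D : ℤ) = (q - 1) * B := by
  obtain ⟨B, hB⟩ := card_sub_one_dvd_levelCount e b D
  refine ⟨B, ?_⟩
  have := h.four_le
  rw [hB, h.card_field]
  push_cast [Nat.cast_sub (show 1 ≤ q by omega)]
  ring

lemma commonZeroCount_ker (i : ι) : commonZeroCount e (LinearMap.ker (e i)) = 1 := by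
  rw [commonZeroCount, Finset.card_eq_one]
  refine ⟨i, ?_⟩
  ext j
  simp only [Finset.mem_filter, Finset.mem_univ, true_and, Finset.mem_singleton]
  exact ⟨fun hij => (h.eq_of_ker_le i j hij).symm, fun hij => hij ▸ le_rfl⟩

lemma finrank_ker (i : ι) : finrank F (LinearMap.ker (e i)) = m + 3 := by
  have h1 := Dual.finrank_ker_add_one_of_ne_zero (h.ne_zero i)
  have h2 := h.finrank_eq
  omega

lemma levelCount_ker_eq (i : ι) :
    ((q : ℤ) - 1) * q ^ (m + 2) +
        s * (q ^ (m + 2) - 1 -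
          levelCount e (q ^ (m + 1) + 2 * q ^ m + s) (LinearMap.ker (e i))) =
      (q - 1) * q ^ m * (q + 2) + q ^ m * (q - 2) * (q ^ (m + 2) - 1) := by
  have := h.levelCount_eq (h.finrank_ker i) (by rw [h.commonZeroCount_ker i]; exact one_pos)
  rw [h.commonZeroCount_ker i] at this
  linear_combination this

lemma levelCount_ker_add (i : ι) :
    levelCount e (q ^ (m + 1) + 2 * q ^ m) (LinearMap.ker (e i)) +
      levelCount e (q ^ (m + 1) + 2 * q ^ m + s) (LinearMap.ker (e i)) + 1 = q ^ (m + 3) := by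
  have hs := h.pos
  rw [← h.finrank_ker i, ← h.card_field, ← card_filter_mem (LinearMap.ker (e i)), levelCount,
    levelCount, ← Finset.card_union_of_disjoint]
  · rw [← Finset.card_insert_of_notMem (a := (0 : U)) (by simp)]
    congr 1
    ext u
    simp only [Finset.mem_insert, Finset.mem_union, Finset.mem_filter, Finset.mem_univ, true_and]
    constructor
    · rintro (rfl | hu | hu)
      · exact zero_mem _
      · exact hu.1
      · exact hu.1
    · intro hu
      by_cases hu0 : u = 0
      · exact Or.inl hu0
      · have := h.values_of_commonZeroCount_pos (D := LinearMap.ker (e i))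
          (by rw [h.commonZeroCount_ker i]; exact one_pos) hu hu0
        rw [h.card_field]
        tauto
  · rw [Finset.disjoint_left]
    intro u hu hu'
    simp only [Finset.mem_filter, Finset.mem_univ, true_and] at hu hu'
    omega

end IsThreeCharacter

end ThreeCharacter

/-! ### Top vectors killed by one functional: their number and the blocking property -/

section ThreeCharacter

variable {F : Type*} [Field F] [Fintype F] {U : Type*} [AddCommGroup U] [Module F U] [Fintype U]
  {ι : Type*} [Fintype ι] {e : ι → Dual F U} {q m s : ℕ}

namespace IsThreeCharacter

/-- For m = 0 the terms of `levelCount_ker_eq` free of s cancel, and s can be divided out. -/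
lemma levelCount_ker_of_zero (h : IsThreeCharacter e q 0 s) (i : ι) :
    (levelCount e (q ^ (0 + 1) + 2 * q ^ 0 + s) (LinearMap.ker (e i)) : ℤ) = (q : ℤ) ^ 2 - 1 := by
  have h1 := h.levelCount_ker_eq i
  have hs : (s : ℤ) ≠ 0 := by exact_mod_cast h.pos.ne'
  have h2 : (s : ℤ) * ((q : ℤ) ^ 2 - 1 -
      levelCount e (q ^ (0 + 1) + 2 * q ^ 0 + s) (LinearMap.ker (e i))) = 0 := by
    linear_combination h1
  rcases mul_eq_zero.mp h2 with h3 | h3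
  · exact absurd h3 hs
  · linarith

/-- There is no such family with `m = 0` and `s = q`. -/
lemma false_of_zero_of_eq (h : IsThreeCharacter e q 0 q) : False := by
  have hq := h.four_le
  have hq' : (4 : ℤ) ≤ q := by exact_mod_cast hq
  set a := q ^ (0 + 1) + 2 * q ^ 0 with ha
  have hcard : ((Fintype.card ι : ℕ) : ℤ) = (q : ℤ) ^ 2 + 2 * q + 2 := by
    rw [h.card_index]; push_cast; ring
  have hsum := sum_levelCount_ker e (b := a) (by
    rw [h.card_index, ha]
    have : 0 < q ^ (0 + 2) := by positivity
    omega)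
  have hi : ∀ i, (levelCount e a (LinearMap.ker (e i)) : ℤ) = q ^ 3 - q ^ 2 := by
    intro i
    have h1 := h.levelCount_ker_of_zero i
    have h2 := h.levelCount_ker_add i
    zify at h2
    rw [h1] at h2
    linear_combination h2
  zify at hsum
  rw [Finset.sum_congr rfl fun i _ => hi i, Finset.sum_const, Finset.card_univ, nsmul_eq_mul,
    hcard] at hsum
  obtain ⟨B, hB⟩ := h.exists_levelCount_eq a ⊤
  rw [hB, ha] at hsum
  push_cast at hsum
  have h1 : ((q : ℤ) - 1) * ((q ^ 2 + 2 * q + 2) * q ^ 2 - (q + 2) * B) = 0 := by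
    linear_combination hsum
  have h2 : ((q : ℤ) ^ 2 + 2 * q + 2) * q ^ 2 - (q + 2) * B = 0 := by
    rcases mul_eq_zero.mp h1 with h1 | h1
    · omega
    · exact h1
  -- Modulo q + 2 one has q ≡ −2, so (q² + 2q + 2)q² ≡ 8. With q ≥ 4 this leaves only q = 6, not a
  -- prime power.
  have h3 : ((q : ℤ) + 2) ∣ 8 := ⟨B - (q ^ 3 + 2 * q - 4), by linear_combination h2⟩
  have h4 : q + 2 ∣ 8 := by exact_mod_cast h3
  have h5 := Nat.le_of_dvd (by norm_num) h4
  have h6 : ∀ x : ℕ, 4 ≤ x → x + 2 ≤ 8 → x + 2 ∣ 8 → x = 6 := by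
    intro x hx hx' hd
    have : x ≤ 6 := by omega
    interval_cases x <;> omega
  have h7 := h.isPrimePow
  rw [h6 q hq h5 h4, isPrimePow_nat_iff_bounded] at h7
  revert h7
  decide

/-- Without top vectors on D the count reads qZ + s = 2q, where Z > 0 functionals vanish on D. As s
> 0, this forces Z = 1 and s = q, the case excluded by `false_of_zero_of_eq`. -/
lemma levelCount_pos_of_zero (h : IsThreeCharacter e q 0 s) {D : Submodule F U}
    (hD : finrank F D = 2) (hZ : 0 < commonZeroCount e D) :
    0 < levelCount e (q ^ (0 + 1) + 2 * q ^ 0 + s) D := by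
  by_contra hneg
  have h1 := h.levelCount_eq (j := 1) hD hZ
  rw [Nat.eq_zero_of_not_pos hneg] at h1
  have hq' : (4 : ℤ) ≤ q := by exact_mod_cast h.four_le
  have h2 : ((q : ℤ) - 1) * (q * commonZeroCount e D + s - 2 * q) = 0 := by
    push_cast at h1
    linear_combination h1
  have h3 : (q : ℤ) * commonZeroCount e D + s = 2 * q := by
    rcases mul_eq_zero.mp h2 with h2 | h2
    · omega
    · linarith
  have hs := h.pos
  have h4 : q * commonZeroCount e D + s = 2 * q := by exact_mod_cast h3
  have h5 : commonZeroCount e D = 1 := by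
    have : commonZeroCount e D < 2 := by
      by_contra! hge
      have := Nat.mul_le_mul_left q hge
      omega
    omega
  have h6 : s = q := by rw [h5] at h4; omega
  subst h6
  exact h.false_of_zero_of_eq

lemma levelCount_map_subtype (e : ι → Dual F U) (b : ℕ) {X : Submodule F U} (Y : Submodule F X) :
    levelCount e b (Y.map X.subtype) = ((Finset.univ.filter fun u : X =>
      u ≠ 0 ∧ zeroCount e (u : U) = b).filter fun u => u ∈ Y).card := by
  symm
  refine Finset.card_bij (fun u _ => (u : U)) (fun u hu => ?_)
    (fun u _ v _ huv => Subtype.ext huv) fun u hu => ?_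
  · simp only [Finset.mem_filter, Finset.mem_univ, true_and] at hu ⊢
    exact ⟨⟨u, hu.2, rfl⟩, by simpa using hu.1.1, hu.1.2⟩
  · simp only [Finset.mem_filter, Finset.mem_univ, true_and] at hu
    obtain ⟨⟨v, hv, rfl⟩, hv0, hvb⟩ := hu
    refine ⟨v, ?_, rfl⟩
    simp only [Finset.mem_filter, Finset.mem_univ, true_and]
    exact ⟨⟨by rintro rfl; simp at hv0, hvb⟩, hv⟩

lemma levelCount_eq_card_filter (e : ι → Dual F U) (b : ℕ) (X : Submodule F U) :
    levelCount e b X =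
      (Finset.univ.filter fun u : X => u ≠ 0 ∧ zeroCount e (u : U) = b).card := by
  have := levelCount_map_subtype e b (⊤ : Submodule F X)
  rw [Submodule.map_top, Submodule.range_subtype] at this
  rw [this]
  simp

/-- A hyperplane section of the family with few vectors of the top level. -/
lemma exists_levelCount_mul_le (h : IsThreeCharacter e q m s) (b : ℕ) (i : ι) :
    ∃ Y ≤ LinearMap.ker (e i), finrank F Y = m + 2 ∧
      q * levelCount e b Y ≤ levelCount e b (LinearMap.ker (e i)) := by
  set X := LinearMap.ker (e i) with hX
  set S : Finset X := Finset.univ.filter fun u => u ≠ 0 ∧ zeroCount e (u : U) = b with hS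
  have hfin : finrank F X = m + 3 := h.finrank_ker i
  obtain ⟨f, hf, hle⟩ := exists_hyperplane_card_mul_le (F := F) (S := S)
    (fun u hu => (Finset.mem_filter.mp hu).2.1) (by omega)
  refine ⟨(LinearMap.ker f).map X.subtype, Submodule.map_subtype_le _ _, ?_, ?_⟩
  · rw [Submodule.finrank_map_subtype_eq]
    have := Dual.finrank_ker_add_one_of_ne_zero hf
    omega
  · rw [levelCount_map_subtype, levelCount_eq_card_filter, ← h.card_field]
    simpa using hle

/-- In `levelCount_ker_eq` more top vectors force a larger s, and q² + q top points would push s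
beyond `h.le`. Consequently some hyperplane section has fewer than q + 1 top points. -/
lemma levelCount_ker_le (h : IsThreeCharacter e q (m + 1) s) {i : ι} {B : ℕ}
    (hB : (levelCount e (q ^ (m + 1 + 1) + 2 * q ^ (m + 1) + s) (LinearMap.ker (e i)) : ℤ) =
      (q - 1) * B) : B < q ^ 2 + q := by
  by_contra! hge
  have h1 := h.levelCount_ker_eq i
  rw [hB] at h1
  have hq : (4 : ℤ) ≤ q := by exact_mod_cast h.four_le
  have hge' : (q : ℤ) ^ 2 + q ≤ B := by exact_mod_cast hge
  have hle : (s : ℤ) + 2 * q ^ (m + 1) + 1 ≤ q ^ (m + 2) + q := by exact_mod_cast h.le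
  have hA : (1 : ℤ) ≤ (q : ℤ) ^ m := one_le_pow₀ (by linarith)
  have hs0 : (0 : ℤ) ≤ s := by positivity
  generalize (q : ℤ) = Q at *
  have e1 : Q ^ (m + 1) = Q * Q ^ m := by ring
  have e2 : Q ^ (m + 2) = Q ^ 2 * Q ^ m := by ring
  have e3 : Q ^ (m + 1 + 2) = Q ^ 3 * Q ^ m := by ring
  rw [e3, e1] at h1
  rw [e1, e2] at hle
  generalize Q ^ m = A at *
  have h2 : (s : ℤ) * ((Q - 1) * (B - (Q ^ 2 + Q))) ≥ 0 :=
    mul_nonneg hs0 (mul_nonneg (by linarith) (by linarith))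
  have h3 : (s : ℤ) * (Q ^ 3 * (A - 1) + Q - 1) ≥ (Q - 2) * Q ^ 3 * A * (Q * A - 1) := by
    nlinarith [h1, h2]
  have h4 : (s : ℤ) * (Q ^ 3 * (A - 1) + Q - 1) ≤
      (Q * A * (Q - 2) + Q - 1) * (Q ^ 3 * (A - 1) + Q - 1) := by
    apply mul_le_mul_of_nonneg_right (by linarith)
    have : 0 ≤ Q ^ 3 * (A - 1) := mul_nonneg (by positivity) (by linarith)
    linarith
  have h5 : (Q - 1) * (Q ^ 3 * A * (Q - 3) + Q ^ 3 - Q ^ 2 * A + 2 * Q * A - Q + 1) ≤ 0 := by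
    linarith
  have h6 : 0 < Q ^ 3 * A * (Q - 3) + Q ^ 3 - Q ^ 2 * A + 2 * Q * A - Q + 1 := by
    have i1 : 0 ≤ Q ^ 3 * A * (Q - 4) := mul_nonneg (by positivity) (by linarith)
    have i2 : 0 ≤ Q ^ 2 * A * (Q - 1) := mul_nonneg (by positivity) (by linarith)
    have i3 : 0 ≤ Q * A := by positivity
    have i4 : Q * 1 ≤ Q * Q ^ 2 := mul_le_mul_of_nonneg_left (by nlinarith) (by linarith)
    nlinarith
  nlinarith [mul_pos (show 0 < Q - 1 by linarith) h6]

/-- Nonnegativity of the top count in `levelCount_ker_eq` bounds s from below. -/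
lemma lt_add_of_succ (h : IsThreeCharacter e q (m + 1) s) (i : ι) :
    (q : ℤ) ^ (m + 1) * (q - 2) - q < s := by
  by_contra! hle
  have h1 := h.levelCount_ker_eq i
  have hq : (4 : ℤ) ≤ q := by exact_mod_cast h.four_le
  have hL : (0 : ℤ) ≤
    levelCount e (q ^ (m + 1 + 1) + 2 * q ^ (m + 1) + s) (LinearMap.ker (e i)) := by positivity
  have hA : (1 : ℤ) ≤ (q : ℤ) ^ m := one_le_pow₀ (by linarith)
  have hs0 : (0 : ℤ) ≤ s := by positivity
  generalize (levelCount e (q ^ (m + 1 + 1) + 2 * q ^ (m + 1) + s) (LinearMap.ker (e i)) : ℤ) = B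
    at *
  generalize (q : ℤ) = Q at *
  have e1 : Q ^ (m + 1) = Q * Q ^ m := by ring
  have e3 : Q ^ (m + 1 + 2) = Q ^ 3 * Q ^ m := by ring
  rw [e3, e1] at h1
  rw [e1] at hle
  generalize Q ^ m = A at *
  have hQ3 : (1 : ℤ) < Q ^ 3 * A := by nlinarith [pow_le_pow_left₀ (by norm_num) hq 3]
  have h2 : (s : ℤ) * (Q ^ 3 * A - 1) ≥ (Q - 2) * Q * A * (Q ^ 3 * A - Q ^ 2) := by
    nlinarith [mul_nonneg hs0 hL]
  have h3 : (s : ℤ) * (Q ^ 3 * A - 1) ≤ (Q * A * (Q - 2) - Q) * (Q ^ 3 * A - 1) :=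
    mul_le_mul_of_nonneg_right hle (by linarith)
  have h4 : Q * (A * (2 * Q ^ 2 + Q - 2) - 1) ≤ 0 := by linarith
  have h5 : 0 < A * (2 * Q ^ 2 + Q - 2) - 1 := by nlinarith
  nlinarith [mul_pos (show 0 < Q by linarith) h5]

/-- Counting on a suitable 3-dimensional subspace gives q ∣ s. The two bounds place s in an open
interval of length 2q whose centre q^(m+1)(q − 2) is the only multiple of q inside. -/
lemma s_eq_of_succ (h : IsThreeCharacter e q (m + 1) s) (i : ι) :
    (s : ℤ) = q ^ (m + 1) * (q - 2) := by
  have hq : (4 : ℤ) ≤ q := by exact_mod_cast h.four_le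
  set b := q ^ (m + 1 + 1) + 2 * q ^ (m + 1) + s with hb
  obtain ⟨Y, hY, hYfin, hYle⟩ := h.exists_levelCount_mul_le b i
  obtain ⟨D, hDY, hD⟩ := exists_le_finrank_eq Y (k := 3) (by omega)
  obtain ⟨B, hB⟩ := h.exists_levelCount_eq b (LinearMap.ker (e i))
  obtain ⟨BD, hBD⟩ := h.exists_levelCount_eq b D
  have hBlt := h.levelCount_ker_le hB
  have hBDlt : BD < q + 1 := by
    have h1 := levelCount_mono e b hDY
    have h2 : (q : ℤ) * levelCount e b D ≤ levelCount e b (LinearMap.ker (e i)) := by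
      exact_mod_cast (Nat.mul_le_mul_left q h1).trans hYle
    rw [hB, hBD] at h2
    have h3 : (B : ℤ) < q ^ 2 + q := by exact_mod_cast hBlt
    have h4 : (q : ℤ) * BD ≤ B := by
      refine le_of_mul_le_mul_left (a := (q : ℤ) - 1) ?_ (by linarith)
      linarith
    have h5 : (BD : ℤ) < q + 1 := by
      refine lt_of_mul_lt_mul_left (a := (q : ℤ)) ?_ (by linarith)
      linarith
    exact_mod_cast h5
  have h1 := h.levelCount_eq (j := 2) hD (commonZeroCount_pos e (hDY.trans hY))
  rw [hBD] at h1
  -- E measures how far D falls short of q + 1 top points; 0 < E ≤ q + 1 < 2q is the range required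
  -- by `dvd_of_sq_dvd_mul`.
  obtain ⟨E, hE⟩ : ∃ E, q + 1 = BD + E := ⟨q + 1 - BD, by omega⟩
  have hE' : (E : ℤ) = q + 1 - BD := by
    have : ((q : ℤ) + 1) = BD + E := by exact_mod_cast hE
    linarith
  have h2 : ((q : ℤ) - 1) * (q ^ 2 * commonZeroCount e D + s * E - q ^ (m + 3)) = 0 := by
    rw [hE']
    linear_combination h1
  have h3 : (q : ℤ) ^ 2 * commonZeroCount e D + s * E = q ^ (m + 3) := by
    rcases mul_eq_zero.mp h2 with h2 | h2
    · omega
    · linarith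
  have h4 : (q : ℤ) ^ 2 ∣ s * E :=
    ⟨q ^ (m + 1) - commonZeroCount e D, by linear_combination h3⟩
  have h5 : q ∣ s := by
    refine dvd_of_sq_dvd_mul (E := E) h.isPrimePow (by exact_mod_cast h4) (by omega) ?_
    have := h.four_le
    omega
  obtain ⟨k, hk⟩ := h5
  have hk' : (s : ℤ) = q * k := by exact_mod_cast hk
  have hlow := h.lt_add_of_succ i
  have hle : (s : ℤ) + 2 * q ^ (m + 1) + 1 ≤ q ^ (m + 2) + q := by exact_mod_cast h.le
  have h6 : (q : ℤ) * (q ^ m * (q - 2) - 1) < q * k := by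
    rw [← hk']; linear_combination hlow
  have h7 : (q : ℤ) * k < q * (q ^ m * (q - 2) + 1) := by
    rw [← hk']; linear_combination hle
  have h8 := lt_of_mul_lt_mul_left h6 (by linarith)
  have h9 := lt_of_mul_lt_mul_left h7 (by linarith)
  have h10 : (k : ℤ) = q ^ m * (q - 2) := by omega
  rw [hk', h10]
  ring

/-- Each functional of the family vanishes at exactly `q ^ 2 - 1` vectors of top level. -/
theorem levelCount_ker (h : IsThreeCharacter e q m s) (i : ι) :
    levelCount e (q ^ (m + 1) + 2 * q ^ m + s) (LinearMap.ker (e i)) = q ^ 2 - 1 := by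
  have h1 : 1 ≤ q ^ 2 := Nat.one_le_pow _ _ (by have := h.four_le; omega)
  zify [h1]
  cases m with
  | zero => exact h.levelCount_ker_of_zero i
  | succ m =>
    have h2 := h.levelCount_ker_eq i
    have hs := h.s_eq_of_succ i
    have hs0 : (s : ℤ) ≠ 0 := by exact_mod_cast h.pos.ne'
    refine mul_left_cancel₀ hs0 ?_
    have h3 : (s : ℤ) * (q ^ (m + 1 + 2) - 1) =
        q ^ (m + 1) * (q - 2) * (q ^ (m + 1 + 2) - 1) := by rw [hs]
    have h4 : (s : ℤ) * (q ^ 2 - 1) = q ^ (m + 1) * (q - 2) * (q ^ 2 - 1) := by rw [hs]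
    linear_combination h3 - h2 - h4

/-- Every hyperplane of the kernel of a functional of the family contains a vector of top
level. -/
theorem levelCount_pos (h : IsThreeCharacter e q m s) {i : ι} {D : Submodule F U}
    (hDi : D ≤ LinearMap.ker (e i)) (hD : finrank F D = m + 2) :
    0 < levelCount e (q ^ (m + 1) + 2 * q ^ m + s) D := by
  have hZ := commonZeroCount_pos e hDi
  cases m with
  | zero => exact h.levelCount_pos_of_zero hD hZ
  | succ m =>
    -- Without top vectors the count collapses to qZ = q + 2, so q ∣ 2, against q ≥ 4.
    by_contra hneg
    have h1 := h.levelCount_eq (j := m + 2) hD hZ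
    rw [Nat.eq_zero_of_not_pos hneg, h.s_eq_of_succ i] at h1
    have hq : (4 : ℤ) ≤ q := by exact_mod_cast h.four_le
    have h2 : (((q : ℤ) - 1) * q ^ (m + 1)) * (q * commonZeroCount e D - (q + 2)) = 0 := by
      push_cast at h1
      linear_combination h1
    have h3 : (q : ℤ) * commonZeroCount e D = q + 2 := by
      rcases mul_eq_zero.mp h2 with h2 | h2
      · have : 0 < ((q : ℤ) - 1) * q ^ (m + 1) :=
          mul_pos (by linarith) (pow_pos (by linarith) _)
        omega
      · linarith
    have h4 : (q : ℤ) ∣ 2 := ⟨commonZeroCount e D - 1, by linear_combination -h3⟩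
    have := Int.le_of_dvd (by norm_num) h4
    omega

end IsThreeCharacter

end ThreeCharacter

/-! ### The plane of top lines and the parameters -/

section ThreeCharacter

variable {F : Type*} [Field F] [Fintype F] {U : Type*} [AddCommGroup U] [Module F U] [Fintype U]
  {ι : Type*} [Fintype ι] {e : ι → Dual F U} {q m s : ℕ}

lemma mem_of_mem_span_singleton {N : Submodule F U} {u v : U} (hv : v ∈ N)
    (huv : v ∈ Submodule.span F {u}) (hv0 : v ≠ 0) : u ∈ N := by
  obtain ⟨a, rfl⟩ := exists_smul_eq_of_mem_span_singleton huv hv0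
  simpa using N.smul_of_tower_mem a⁻¹ hv

lemma le_of_finrank_eq_two {L T : Submodule F U} (hL : finrank F L = 2) {x y : U} (hxL : x ∈ L)
    (hyL : y ∈ L) (hxT : x ∈ T) (hyT : y ∈ T) (hx : x ≠ 0) (hyx : y ∉ Submodule.span F {x}) :
    L ≤ T := by
  have h1 : Submodule.span F {x, y} ≤ L := by
    rw [Submodule.span_le]
    rintro z (rfl | rfl) <;> assumption
  rw [← Submodule.eq_of_le_of_finrank_eq h1 (by rw [hL, finrank_span_pair_eq_two hx hyx]),
    Submodule.span_le]
  rintro z (rfl | rfl) <;> assumption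

/-- Pairwise intersecting lines without a common point lie in a plane. -/
lemma exists_plane_of_pairwise_meet [Nonempty ι] {L : ι → Submodule F U}
    (hL : ∀ i, finrank F (L i) = 2) (hmeet : ∀ i j, ∃ u ∈ L i, u ∈ L j ∧ u ≠ 0)
    (hno : ∀ u ≠ 0, ∃ i, u ∉ L i) :
    ∃ T : Submodule F U, finrank F T = 3 ∧ ∀ i, L i ≤ T := by
  obtain ⟨i⟩ := ‹Nonempty ι›
  obtain ⟨w, hwi, -, hw0⟩ := hmeet i i
  obtain ⟨j, hwj⟩ := hno w hw0
  obtain ⟨u, hui, huj, hu0⟩ := hmeet i j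
  have hlt : finrank F ↥(L i ⊓ L j) < finrank F (L i) :=
    Submodule.finrank_lt_finrank_of_lt (lt_of_le_of_ne inf_le_left fun he => hwj (by
      rw [← he] at hwi
      exact hwi.2))
  have hle : Submodule.span F {u} ≤ L i ⊓ L j :=
    (Submodule.span_singleton_le_iff_mem _ _).mpr ⟨hui, huj⟩
  have h1 := Submodule.finrank_mono hle
  rw [hL] at hlt
  rw [finrank_span_singleton hu0] at h1
  have hinf : Submodule.span F {u} = L i ⊓ L j :=
    Submodule.eq_of_le_of_finrank_eq hle (by rw [finrank_span_singleton hu0]; omega)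
  have hsup := Submodule.finrank_sup_add_finrank_inf_eq (L i) (L j)
  rw [hL, hL] at hsup
  -- A line missing u meets `L i` and `L j` in distinct points, hence lies in their span. A line
  -- through u gets its second point in the plane from a line missing u.
  have hstep : ∀ k, u ∉ L k → L k ≤ L i ⊔ L j := by
    intro k huk
    obtain ⟨x, hxi, hxk, hx0⟩ := hmeet i k
    obtain ⟨y, hyj, hyk, hy0⟩ := hmeet j k
    refine le_of_finrank_eq_two (hL k) hxk hyk (Submodule.mem_sup_left hxi)
      (Submodule.mem_sup_right hyj) hx0 fun hyx => huk ?_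
    have hyi : y ∈ L i := (Submodule.span_singleton_le_iff_mem _ _).mpr hxi hyx
    exact mem_of_mem_span_singleton hyk (hinf ▸ ⟨hyi, hyj⟩) hy0
  refine ⟨L i ⊔ L j, by omega, fun l => ?_⟩
  by_cases hul : u ∈ L l
  · obtain ⟨k, huk⟩ := hno u hu0
    obtain ⟨v, hvk, hvl, hv0⟩ := hmeet k l
    exact le_of_finrank_eq_two (hL l) hul hvl (Submodule.mem_sup_left hui) (hstep k huk hvk) hu0
      fun hvu => huk (mem_of_mem_span_singleton hvk hvu hv0)
  · exact hstep l hul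

/-- For q a power of p, the quotient b / q^(m+1) is a positive power of p less than 3, hence 2. -/
lemma even_and_eq_two_mul_of_dvd_pow {b : ℕ} (hq : IsPrimePow q) (hb : b ∣ q ^ (m + 2))
    (hlt : q ^ (m + 1) < b) (hlt' : b < 3 * q ^ (m + 1)) : Even q ∧ b = 2 * q ^ (m + 1) := by
  obtain ⟨p, k, hp, hk, rfl⟩ := hq
  have hp' : p.Prime := hp.nat_prime
  rw [← pow_mul] at hb hlt hlt' ⊢
  obtain ⟨i, -, rfl⟩ := (Nat.dvd_prime_pow hp').mp hb
  have h1 := (Nat.pow_lt_pow_iff_right hp'.one_lt).mp hlt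
  obtain ⟨d, rfl⟩ : ∃ d, i = k * (m + 1) + (d + 1) := ⟨i - k * (m + 1) - 1, by omega⟩
  rw [pow_add, mul_comm 3] at hlt'
  have h2 := lt_of_mul_lt_mul_left hlt' (Nat.zero_le _)
  have h3 : p ≤ p ^ (d + 1) := Nat.le_self_pow (by omega) p
  have hp2 : p = 2 := by have := hp'.two_le; omega
  subst hp2
  refine ⟨(Nat.even_pow.mpr ⟨even_two, hk.ne'⟩), ?_⟩
  have h4 : d = 0 := by
    by_contra hd
    have : 2 ^ 2 ≤ 2 ^ (d + 1) := Nat.pow_le_pow_right (by norm_num) (by omega)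
    omega
  rw [h4, pow_add]
  ring

namespace IsThreeCharacter

variable (h : IsThreeCharacter e q m s)
include h

/-- The vectors of top level killed by a functional of the family form a line. -/
lemma exists_line (i : ι) : ∃ L ≤ LinearMap.ker (e i), finrank F L = 2 ∧
    ∀ u ∈ LinearMap.ker (e i), u ≠ 0 →
      (u ∈ L ↔ zeroCount e u = q ^ (m + 1) + 2 * q ^ m + s) := by
  set b := q ^ (m + 1) + 2 * q ^ m + s with hb
  set X := LinearMap.ker (e i) with hX
  have hfin : finrank F X = m + 3 := h.finrank_ker i
  have key : ∀ Y : Submodule F X, finrank F Y = m + 2 →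
      ∃ u ∈ Finset.univ.filter (fun u : X => u ≠ 0 ∧ zeroCount e (u : U) = b), u ∈ Y := by
    intro Y hY
    have h1 := h.levelCount_pos (i := i) (D := Y.map X.subtype) (Submodule.map_subtype_le _ _)
      (by rw [Submodule.finrank_map_subtype_eq, hY])
    rw [levelCount_map_subtype] at h1
    obtain ⟨u, hu⟩ := Finset.card_pos.mp h1
    exact ⟨u, Finset.mem_filter.mp hu⟩
  obtain ⟨L, hL, hLS⟩ := exists_line_of_blocking (F := F)
    (S := Finset.univ.filter fun u : X => u ≠ 0 ∧ zeroCount e (u : U) = b)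
    (fun u hu => (Finset.mem_filter.mp hu).2.1)
    (fun u hu a => by
      simp only [Finset.mem_filter, Finset.mem_univ, true_and] at hu ⊢
      refine ⟨by simpa [smul_eq_zero_iff_eq] using hu.1, ?_⟩
      exact (zeroCount_smul e a (u : U)).trans hu.2)
    (by rw [← levelCount_eq_card_filter, h.levelCount_ker, h.card_field])
    (fun f => by
      obtain ⟨Y, hY, hY'⟩ := exists_le_finrank_eq (LinearMap.ker f) (k := m + 2) (by
        by_cases hf : f = 0
        · rw [hf, LinearMap.ker_zero, finrank_top]; omega
        · have := Dual.finrank_ker_add_one_of_ne_zero hf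
          omega)
      obtain ⟨u, hu, huY⟩ := key Y hY'
      exact ⟨u, hu, hY huY⟩)
  refine ⟨L.map X.subtype, Submodule.map_subtype_le _ _,
    by rw [Submodule.finrank_map_subtype_eq, hL], fun u hu hu0 => ?_⟩
  have h1 := hLS ⟨u, hu⟩ (by simpa using hu0)
  simp only [Finset.mem_filter, Finset.mem_univ, true_and] at h1
  constructor
  · rintro ⟨v, hv, rfl⟩
    exact (h1.mp hv).2
  · intro hub
    exact ⟨⟨u, hu⟩, h1.mpr ⟨by simpa using hu0, hub⟩, rfl⟩

lemma zeroCount_ne_card {u : U} (hu : u ≠ 0) : zeroCount e u ≠ Fintype.card ι := by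
  have hpos : 0 < q ^ (m + 2) := pow_pos (by have := h.four_le; omega) _
  have hs := h.pos
  rw [h.card_index]
  rcases h.values u hu with h1 | h1 | h1 <;> omega

lemma nonempty_index : Nonempty ι := by
  have hs := h.pos
  rw [← Fintype.card_pos_iff, h.card_index]
  omega

/-- The plane spanned by the lines of vectors of top level. -/
theorem exists_plane : ∃ T : Submodule F U, finrank F T = 3 ∧
    (∀ i, ¬ T ≤ LinearMap.ker (e i)) ∧
    (∀ i, commonZeroCount e (T ⊓ LinearMap.ker (e i)) = 2 * q ^ m + s) ∧
    ∀ u ∈ T, u ≠ 0 → zeroCount e u = 0 ∨ zeroCount e u = q ^ (m + 1) + 2 * q ^ m + s := by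
  choose L hLe hL hLb using h.exists_line
  have hne := h.nonempty_index
  have hnz : ∀ D : Submodule F U, 0 < finrank F D → ∃ u ∈ D, u ≠ 0 := fun D hD =>
    Submodule.exists_mem_ne_zero_of_ne_bot (by rintro rfl; simp at hD)
  -- A common point of the lines would be a hyperplane containing every column.
  have hno : ∀ u ≠ 0, ∃ i, u ∉ L i := by
    intro u hu
    by_contra! hcon
    refine h.zeroCount_ne_card hu ?_
    rw [zeroCount, Finset.filter_true_of_mem (p := fun i => e i u = 0)
      fun i _ => hLe i (hcon i), Finset.card_univ]
  have heq : ∀ i j, L i ≤ LinearMap.ker (e j) → L i = L j := by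
    intro i j hij
    refine Submodule.eq_of_le_of_finrank_eq (fun u hu => ?_) (by rw [hL, hL])
    by_cases hu0 : u = 0
    · rw [hu0]; exact zero_mem _
    · exact (hLb j u (hij hu) hu0).mpr ((hLb i u (hLe i hu) hu0).mp hu)
  have hmeet : ∀ i j, ∃ u ∈ L i, u ∈ L j ∧ u ≠ 0 := by
    intro i j
    by_cases hij : L i ≤ LinearMap.ker (e j)
    · obtain ⟨u, hu, hu0⟩ := hnz (L i) (by rw [hL]; norm_num)
      exact ⟨u, hu, heq i j hij ▸ hu, hu0⟩
    -- A nonzero vector of `L i` killed by `e j` has top level, so it belongs to `L j`.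
    · have h1 := finrank_inf_ker_add_one hij
      rw [hL] at h1
      obtain ⟨u, hu, hu0⟩ := hnz (L i ⊓ LinearMap.ker (e j)) (by omega)
      exact ⟨u, hu.1, (hLb j u hu.2 hu0).mpr ((hLb i u (hLe i hu.1) hu0).mp hu.1), hu0⟩
  obtain ⟨T, hT, hLT⟩ := exists_plane_of_pairwise_meet hL hmeet hno
  -- If `e i` vanished on T, `heq` would make all the lines coincide.
  have hTn : ∀ i, ¬ T ≤ LinearMap.ker (e i) := by
    intro i hTi
    obtain ⟨u, hu, hu0⟩ := hnz (L i) (by rw [hL]; norm_num)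
    obtain ⟨j, hj⟩ := hno u hu0
    exact hj (by rw [heq j i ((hLT j).trans hTi)]; exact hu)
  have hLi : ∀ i, L i = T ⊓ LinearMap.ker (e i) := by
    intro i
    refine Submodule.eq_of_le_of_finrank_eq (le_inf (hLT i) (hLe i)) ?_
    have := finrank_inf_ker_add_one (hTn i)
    rw [hL]
    omega
  refine ⟨T, hT, hTn, fun i => ?_, fun u hu hu0 => ?_⟩
  · rw [← hLi]
    -- All q² − 1 nonzero vectors of `L i` are top; the count with j = 1 then yields the number of
    -- functionals vanishing on `L i`.
    have hlev : levelCount e (q ^ (m + 1) + 2 * q ^ m + s) (L i) = q ^ 2 - 1 := by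
      rw [← h.levelCount_ker i, levelCount, levelCount]
      congr 1
      ext u
      simp only [Finset.mem_filter, Finset.mem_univ, true_and]
      exact ⟨fun hu => ⟨hLe i hu.1, hu.2⟩, fun hu => ⟨(hLb i u hu.1 hu.2.1).mpr hu.2.2, hu.2⟩⟩
    have h1 := h.levelCount_eq (j := 1) (hL i) (commonZeroCount_pos e (hLe i))
    have hq4 := h.four_le
    have hq : (4 : ℤ) ≤ q := by exact_mod_cast hq4
    rw [hlev] at h1
    push_cast [Nat.cast_sub (Nat.one_le_pow 2 q (by omega))] at h1
    have h2 : (((q : ℤ) - 1) * q) * (commonZeroCount e (L i) - (2 * q ^ m + s)) = 0 := by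
      linear_combination h1
    have h3 : ((q : ℤ) - 1) * q ≠ 0 := mul_ne_zero (by omega) (by omega)
    have h4 := (mul_eq_zero.mp h2).resolve_left h3
    zify
    linarith
  · rcases Nat.eq_zero_or_pos (zeroCount e u) with h1 | h1
    · exact Or.inl h1
    · obtain ⟨i, hi⟩ := Finset.card_pos.mp h1
      have hui : u ∈ LinearMap.ker (e i) := (Finset.mem_filter.mp hi).2
      exact Or.inr ((hLb i u hui hu0).mp (by rw [hLi]; exact ⟨hu, hui⟩))

/-- The parameters of the family: `q` is even and `t = q ^ (m + 1)`. -/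
theorem even_and_eq {T : Submodule F U} (hT : finrank F T = 3)
    (hTn : ∀ i, ¬ T ≤ LinearMap.ker (e i))
    (hval : ∀ u ∈ T, u ≠ 0 →
      zeroCount e u = 0 ∨ zeroCount e u = q ^ (m + 1) + 2 * q ^ m + s) :
    Even q ∧ 2 * q ^ m + s = q ^ (m + 1) := by
  set b := q ^ (m + 1) + 2 * q ^ m + s with hb
  have hs := h.pos
  have hq4 := h.four_le
  have hq : (4 : ℤ) ≤ q := by exact_mod_cast hq4
  have hbz : (b : ℤ) = q ^ (m + 1) + 2 * q ^ m + s := by rw [hb]; push_cast; ring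
  have hcount : ∀ (D : Submodule F U) (j : ℕ), D ≤ T → finrank F D = j + 1 →
      commonZeroCount e D = 0 →
      (q : ℤ) ^ j * (q ^ (m + 2) + b) = q ^ (m + 2) + b + b * levelCount e b D := by
    intro D j hDT hD hZ
    have h1 := sum_zeroCount_of_two_values e (a := 0) (s := b) (by omega) hD
      (fun u hu hu0 => by rw [zero_add]; exact hval u (hDT hu) hu0)
    rw [hZ, h.card_field, zero_add, h.card_index] at h1
    push_cast at h1
    rw [hbz] at h1 ⊢
    linear_combination h1
  have hZT : commonZeroCount e T = 0 := by
    rw [commonZeroCount, Finset.card_eq_zero, Finset.filter_eq_empty_iff]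
    exact fun i _ => hTn i
  -- If all of T∖{0} were top, the count on T would give b = q^m(q + 1), which is too small.
  obtain ⟨u, huT, hu0, hu⟩ : ∃ u ∈ T, u ≠ 0 ∧ zeroCount e u = 0 := by
    by_contra! hcon
    have hlev : levelCount e b T + 1 = q ^ 3 := by
      rw [← hT, ← h.card_field, ← card_filter_mem T, levelCount,
        ← Finset.card_erase_add_one (s := Finset.univ.filter (· ∈ T)) (a := 0) (by simp)]
      congr 2
      ext u
      simp only [Finset.mem_filter, Finset.mem_univ, true_and, Finset.mem_erase]
      exact ⟨fun hu => ⟨hu.2.1, hu.1⟩, fun hu => ⟨hu.2, hu.1,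
        (hval u hu.2 hu.1).resolve_left (hcon u hu.2 hu.1)⟩⟩
    have h1 := hcount T 2 le_rfl hT hZT
    zify at hlev
    rw [← sub_eq_iff_eq_add.mpr hlev.symm, hbz] at h1
    have h2 : (((q : ℤ) - 1) * q ^ 2) * (q ^ m + s) = 0 := by linear_combination -h1
    have h3 : (0 : ℤ) < ((q : ℤ) - 1) * q ^ 2 := mul_pos (by linarith) (by positivity)
    have h4 : (0 : ℤ) < q ^ m + s := by positivity
    exact (mul_pos h3 h4).ne' h2
  -- On a line of T through u no functional vanishes identically, so its B top points account for
  -- every functional exactly once: q^(m+2) + b = bB.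
  obtain ⟨v, hvT, hv⟩ : ∃ v ∈ T, v ∉ Submodule.span F {u} := by
    by_contra! hcon
    have := finrank_le_one_of_forall_mem_span hcon
    omega
  have hDT : Submodule.span F {u, v} ≤ T := by
    rw [Submodule.span_le]
    rintro z (rfl | rfl) <;> assumption
  have hZD : commonZeroCount e (Submodule.span F {u, v}) = 0 := by
    have := commonZeroCount_le_zeroCount e (D := Submodule.span F {u, v}) (u := u)
      (Submodule.subset_span (by simp))
    omega
  have h1 := hcount _ 1 hDT (finrank_span_pair_eq_two hu0 hv) hZD
  obtain ⟨B, hB⟩ := h.exists_levelCount_eq b (Submodule.span F {u, v})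
  rw [hB] at h1
  have h2 : ((q : ℤ) - 1) * (q ^ (m + 2) + b - b * B) = 0 := by linear_combination h1
  have h3 := (mul_eq_zero.mp h2).resolve_left (by omega)
  have h4 : b ∣ q ^ (m + 2) := by
    have : (b : ℤ) ∣ (q : ℤ) ^ (m + 2) := ⟨B - 1, by linear_combination h3⟩
    exact_mod_cast this
  have hle := h.le
  have h5 : q ≤ q ^ (m + 1) := Nat.le_self_pow (by omega) q
  obtain ⟨h6, h7⟩ := even_and_eq_two_mul_of_dvd_pow h.isPrimePow h4 (by omega) (by omega)
  exact ⟨h6, by omega⟩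

end IsThreeCharacter

end ThreeCharacter

/-! ### Back to the points: vertex, base hyperoval and cone -/

section Cone

variable {F : Type*} [Field F] [Fintype F] {V : Type*} [AddCommGroup V] [Module F V] [Fintype V]
  [Fintype (Dual F V)] {ι : Type*} [Fintype ι] {g : ι → V} {q m s : ℕ}

namespace IsThreeCharacter

variable (h : IsThreeCharacter (fun i => Dual.eval F V (g i)) q m s)
include h

lemma vector_ne_zero (i : ι) : g i ≠ 0 := fun hi => h.ne_zero i (by simp [hi])

lemma eq_of_smul_eq {i j : ι} {c : F} (hij : g j = c • g i) : i = j := by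
  refine h.eq_of_ker_le i j fun f hf => ?_
  have hf' : f (g i) = 0 := hf
  change f (g j) = 0
  rw [hij, map_smul, hf', smul_zero]

/-- The columns in a cone over a point exhaust the affine part of that cone. -/
lemma exists_smul_eq_of_mem {π M : Submodule F V} (hπM : π ≤ M) (hπ : finrank F π = m + 1)
    (hM : finrank F M = m + 2) (hgπ : ∀ i, g i ∉ π)
    (hcount : (Finset.univ.filter fun i => g i ∈ M).card = q ^ (m + 1)) {v : V} (hv : v ∈ M)
    (hvπ : v ∉ π) : ∃ (i : ι) (a : Fˣ), a • g i = v := by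
  set A : Finset (ι × Fˣ) := (Finset.univ.filter fun i => g i ∈ M) ×ˢ Finset.univ with hA
  have hinj : Function.Injective fun p : ι × Fˣ => p.2 • g p.1 := by
    rintro ⟨i, a⟩ ⟨j, b⟩ hab
    have h1 : g j = ((b⁻¹ * a : Fˣ) : F) • g i := by
      rw [← Units.smul_def, mul_smul]
      exact eq_inv_smul_iff.mpr hab.symm
    obtain rfl := h.eq_of_smul_eq h1
    have h2 : (a : F) • g i = (b : F) • g i := hab
    rw [Units.ext (smul_left_injective F (h.vector_ne_zero i) h2)]
  have hsub : A.image (fun p => p.2 • g p.1) ⊆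
      Finset.univ.filter (· ∈ M) \ Finset.univ.filter (· ∈ π) := by
    intro w hw
    obtain ⟨⟨i, a⟩, hp, rfl⟩ := Finset.mem_image.mp hw
    simp only [hA, Finset.mem_product, Finset.mem_filter, Finset.mem_univ, true_and,
      and_true] at hp
    simp only [Finset.mem_sdiff, Finset.mem_filter, Finset.mem_univ, true_and]
    refine ⟨M.smul_of_tower_mem a hp, fun hmem => hgπ i ?_⟩
    simpa using π.smul_of_tower_mem a⁻¹ hmem
  -- Both sets have q^(m+1)(q − 1) elements.
  have hcard := Finset.eq_of_subset_of_card_le hsub (by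
    rw [Finset.card_image_of_injective _ hinj, hA, Finset.card_product, hcount,
      Finset.card_univ, Fintype.card_units, Finset.card_sdiff_of_subset, card_filter_mem,
      card_filter_mem, hπ, hM, h.card_field]
    · rw [Nat.mul_sub, mul_one, ← pow_succ]
    · intro w hw
      simp only [Finset.mem_filter, Finset.mem_univ, true_and] at hw ⊢
      exact hπM hw)
  have hv' : v ∈ Finset.univ.filter (· ∈ M) \ Finset.univ.filter (· ∈ π) := by
    simp [hv, hvπ]
  rw [← hcard] at hv'
  obtain ⟨⟨i, a⟩, -, hp⟩ := Finset.mem_image.mp hv'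
  exact ⟨i, a, hp⟩

lemma finrank_vector_space : finrank F V = m + 4 := by
  rw [← Subspace.dual_finrank_eq, h.finrank_eq]

/-- The vertex of the cone. -/
theorem exists_vertex : Even q ∧ 2 * q ^ m + s = q ^ (m + 1) ∧
    ∃ π : Submodule F V, finrank F π = m + 1 ∧ (∀ i, g i ∉ π) ∧
      ∀ i, finrank F ↥(Submodule.span F {g i} ⊔ π) = m + 2 ∧
        (Finset.univ.filter fun j => g j ∈ Submodule.span F {g i} ⊔ π).card = q ^ (m + 1) := by
  obtain ⟨T, hT, hTn, hTc, hval⟩ := h.exists_plane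
  obtain ⟨hev, hs⟩ := h.even_and_eq hT hTn hval
  have hV := h.finrank_vector_space
  refine ⟨hev, hs, T.dualCoannihilator, ?_, fun i hi => hTn i fun f hf =>
    (Submodule.mem_dualCoannihilator (g i)).mp hi f hf, fun i => ?_⟩
  · have : finrank F T + finrank F T.dualCoannihilator = finrank F V :=
      Subspace.finrank_add_finrank_dualCoannihilator_eq T
    omega
  -- By duality the span of `g i` and π is the annihilator of D, so the columns in it are the
  -- functionals vanishing on D.
  set D := T ⊓ LinearMap.ker (Dual.eval F V (g i)) with hD
  have hDf : finrank F D + 1 = finrank F T := finrank_inf_ker_add_one (hTn i)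
  have h1 : finrank F T + finrank F T.dualCoannihilator = finrank F V :=
    Subspace.finrank_add_finrank_dualCoannihilator_eq T
  have h2 : finrank F D + finrank F D.dualCoannihilator = finrank F V :=
    Subspace.finrank_add_finrank_dualCoannihilator_eq D
  have hgi : g i ∉ T.dualCoannihilator := fun hi => hTn i fun f hf =>
    (Submodule.mem_dualCoannihilator (g i)).mp hi f hf
  have hle : Submodule.span F {g i} ⊔ T.dualCoannihilator ≤ D.dualCoannihilator := by
    refine sup_le ?_ (Submodule.dualCoannihilator_anti inf_le_left)
    rw [Submodule.span_singleton_le_iff_mem, Submodule.mem_dualCoannihilator]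
    exact fun f hf => hf.2
  have hlt : finrank F T.dualCoannihilator <
      finrank F ↥(Submodule.span F {g i} ⊔ T.dualCoannihilator) := by
    refine Submodule.finrank_lt_finrank_of_lt (lt_of_le_of_ne le_sup_right fun he => hgi ?_)
    rw [he]
    exact Submodule.mem_sup_left (Submodule.mem_span_singleton_self _)
  have h3 := Submodule.finrank_mono hle
  have hMD : Submodule.span F {g i} ⊔ T.dualCoannihilator = D.dualCoannihilator :=
    Submodule.eq_of_le_of_finrank_eq hle (by omega)
  refine ⟨by omega, ?_⟩
  rw [← hs, ← hTc i, commonZeroCount, hMD]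
  congr 1
  ext j
  simp only [Finset.mem_filter, Finset.mem_univ, true_and, Submodule.mem_dualCoannihilator]
  exact Iff.rfl

/-- The points of the family form a cone over a hyperoval, minus its vertex. -/
theorem exists_cone : Even q ∧ 2 * q ^ m + s = q ^ (m + 1) ∧
    ∃ (π σ : Submodule F V) (H : Set (ℙ F V)), IsCompl π σ ∧ finrank F π = m + 1 ∧
      IsHyperovalIn σ H ∧
      Set.range (fun i => Projectivization.mk F (g i) (h.vector_ne_zero i)) =
        cone π H \ pointsOf π := by
  obtain ⟨hev, hs, π, hπ, hgπ, hM⟩ := h.exists_vertex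
  refine ⟨hev, hs, ?_⟩
  have hV := h.finrank_vector_space
  -- Any complement of π serves as the plane; the base is the projection of the columns onto it
  -- along π.
  obtain ⟨σ, hσ⟩ := Submodule.exists_isCompl π
  have hdec : ∀ i, ∃ p ∈ π, ∃ c ∈ σ, p + c = g i := fun i =>
    Submodule.mem_sup.mp (by rw [hσ.sup_eq_top]; exact Submodule.mem_top)
  choose p hp c hc hpc using hdec
  have hc0 : ∀ i, c i ≠ 0 := fun i hi => hgπ i (by rw [← hpc, hi, add_zero]; exact hp i)
  have hspan : ∀ i, Submodule.span F {c i} ⊔ π = Submodule.span F {g i} ⊔ π := by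
    intro i
    apply le_antisymm <;> refine sup_le ?_ le_sup_right <;>
      rw [Submodule.span_singleton_le_iff_mem]
    · rw [show c i = g i - p i by rw [← hpc]; abel]
      exact Submodule.sub_mem _
        (Submodule.mem_sup_left (Submodule.mem_span_singleton_self _))
        (Submodule.mem_sup_right (hp i))
    · rw [← hpc]
      exact Submodule.add_mem _ (Submodule.mem_sup_right (hp i))
        (Submodule.mem_sup_left (Submodule.mem_span_singleton_self _))
  set P : ι → ℙ F V := fun i => Projectivization.mk F (c i) (hc0 i) with hP
  have hPeq : ∀ i j, P j = P i ↔ g j ∈ Submodule.span F {g i} ⊔ π := by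
    intro i j
    rw [← hspan i, hP]
    simp only [Projectivization.mk_eq_mk_iff']
    constructor
    · rintro ⟨a, ha⟩
      rw [← hpc j, ← ha]
      exact Submodule.add_mem _ (Submodule.mem_sup_right (hp j)) (Submodule.mem_sup_left
        (Submodule.smul_mem _ _ (Submodule.mem_span_singleton_self _)))
    · intro hj
      obtain ⟨x, hx, y, hy, hxy⟩ := Submodule.mem_sup.mp hj
      obtain ⟨a, rfl⟩ := Submodule.mem_span_singleton.mp hx
      refine ⟨a, ?_⟩
      have h1 : a • c i - c j ∈ σ := σ.sub_mem (σ.smul_mem a (hc i)) (hc j)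
      have h2 : a • c i - c j ∈ π := by
        have : a • c i - c j = p j - y := by
          rw [sub_eq_sub_iff_add_eq_add, hxy, hpc]
        rw [this]
        exact π.sub_mem (hp j) hy
      exact sub_eq_zero.mp (Submodule.disjoint_def.mp hσ.disjoint _ h2 h1)
  have hfib : ∀ i, (Finset.univ.filter fun j => P j = P i).card = q ^ (m + 1) := by
    intro i
    simp only [hPeq]
    exact (hM i).2
  refine ⟨π, σ, Set.range P, hσ, hπ, ⟨?_, ?_, ?_, ?_⟩, ?_⟩
  · have := Submodule.finrank_add_eq_of_isCompl hσ
    omega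
  · rintro _ ⟨i, rfl⟩
    change (P i).submodule ≤ σ
    rw [hP, Projectivization.submodule_mk, Submodule.span_singleton_le_iff_mem]
    exact hc i
  -- The q^(m+2) + 2q^(m+1) columns fall into fibres of size q^(m+1), which leaves q + 2 points.
  · have h1 := Finset.card_eq_sum_card_image P Finset.univ
    rw [Finset.sum_const_nat (m := q ^ (m + 1)) (fun b hb => by
      obtain ⟨i, -, rfl⟩ := Finset.mem_image.mp hb
      exact hfib i), Finset.card_univ, h.card_index] at h1
    have hpos : 0 < q ^ (m + 1) := pow_pos (by have := h.four_le; omega) _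
    rw [← Set.image_univ, ← Finset.coe_univ, ← Finset.coe_image, Set.ncard_coe_finset,
      Nat.card_eq_fintype_card, h.card_field]
    refine Nat.eq_of_mul_eq_mul_right hpos ?_
    rw [← h1, add_assoc, hs]
    ring
  · rintro _ ⟨i, rfl⟩ _ ⟨j, rfl⟩ _ ⟨k, rfl⟩ hij hik hjk ⟨L, hL, hiL, hjL, hkL⟩
    -- A line through three base points lies with π in a hyperplane, which would contain at least
    -- 3q^(m+1) columns, while b = 2q^(m+1).
    have hlt : L ⊔ π < ⊤ := by
      refine lt_top_iff_ne_top.mpr fun htop => ?_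
      have h1 := Submodule.finrank_add_le_finrank_add_finrank L π
      rw [htop, finrank_top] at h1
      omega
    obtain ⟨f, hf0, hf⟩ := Submodule.exists_le_ker_of_lt_top _ hlt
    have hker : ∀ l l', P l ∈ pointsOf L → P l' = P l → f (g l') = 0 := by
      intro l l' hl hll
      have h1 : c l ∈ L := by
        have : (P l).submodule ≤ L := hl
        rwa [hP, Projectivization.submodule_mk, Submodule.span_singleton_le_iff_mem] at this
      have h2 := (hPeq l l').mp hll
      rw [← hspan] at h2
      exact hf (sup_le_sup_right ((Submodule.span_singleton_le_iff_mem _ _).mpr h1) π h2)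
    have hdisj : ∀ Q R : ℙ F V, Q ≠ R → Disjoint (Finset.univ.filter fun l => P l = Q)
        (Finset.univ.filter fun l => P l = R) := by
      intro Q R hQR
      rw [Finset.disjoint_left]
      intro l hl hl'
      exact hQR ((Finset.mem_filter.mp hl).2.symm.trans (Finset.mem_filter.mp hl').2)
    have hle : ((Finset.univ.filter fun l => P l = P i) ∪ (Finset.univ.filter fun l => P l = P j) ∪
        (Finset.univ.filter fun l => P l = P k)).card ≤
        zeroCount (fun i => Dual.eval F V (g i)) f := by
      refine Finset.card_le_card fun l hl => ?_
      simp only [Finset.mem_union, Finset.mem_filter, Finset.mem_univ, true_and] at hl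
      rcases hl with (hl | hl) | hl
      · exact Finset.mem_filter.mpr ⟨Finset.mem_univ _, hker i l hiL hl⟩
      · exact Finset.mem_filter.mpr ⟨Finset.mem_univ _, hker j l hjL hl⟩
      · exact Finset.mem_filter.mpr ⟨Finset.mem_univ _, hker k l hkL hl⟩
    rw [Finset.card_union_of_disjoint (Finset.disjoint_union_left.mpr
      ⟨hdisj _ _ hik, hdisj _ _ hjk⟩), Finset.card_union_of_disjoint (hdisj _ _ hij), hfib, hfib,
      hfib] at hle
    have hpos : 0 < q ^ (m + 1) := pow_pos (by have := h.four_le; omega) _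
    rcases h.values f hf0 with h1 | h1 | h1 <;> omega
  · ext Q
    constructor
    · rintro ⟨i, rfl⟩
      refine ⟨Set.mem_biUnion ⟨i, rfl⟩ ?_, fun hmem => hgπ i ?_⟩
      · change Projectivization.submodule _ ≤ _
        rw [hP, Projectivization.submodule_mk, Projectivization.submodule_mk, hspan]
        exact le_sup_left
      · have : Projectivization.submodule _ ≤ π := hmem
        rwa [Projectivization.submodule_mk, Submodule.span_singleton_le_iff_mem] at this
    · rintro ⟨hQ, hQπ⟩
      obtain ⟨_, ⟨i, rfl⟩, hQi⟩ := Set.mem_iUnion₂.mp hQ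
      induction Q using Projectivization.ind with
      | h v hv =>
        have h1 : (Projectivization.mk F v hv).submodule ≤ (P i).submodule ⊔ π := hQi
        rw [hP, Projectivization.submodule_mk, Projectivization.submodule_mk, hspan,
          Submodule.span_singleton_le_iff_mem] at h1
        have h2 : v ∉ π := fun hvπ => hQπ (by
          change Projectivization.submodule _ ≤ π
          rwa [Projectivization.submodule_mk, Submodule.span_singleton_le_iff_mem])
        obtain ⟨j, a, ha⟩ := h.exists_smul_eq_of_mem le_sup_right hπ (hM i).1 hgπ (hM i).2 h1 h2
        refine ⟨j, ?_⟩
        rw [Projectivization.mk_eq_mk_iff']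
        exact ⟨((a⁻¹ : Fˣ) : F), by rw [← Units.smul_def, ← ha, inv_smul_smul]⟩

end IsThreeCharacter

end Cone

/-! ### Codewords as functionals evaluated at columns -/

section Code

variable {F : Type*} [Field F] {k n : ℕ}

/-- The codeword obtained by evaluating a functional at the columns of a matrix. -/
lemma functional_col_eq (G : Matrix (Fin k) (Fin n) F) (f : Dual F (Fin k → F)) :
    (fun j => f (G.col j)) = ∑ i, f (Pi.single i 1) • G.row i := by
  ext j
  rw [LinearMap.pi_apply_eq_sum_univ f (G.col j), Finset.sum_apply]
  refine Finset.sum_congr rfl fun i _ => ?_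
  rw [Pi.smul_apply, smul_eq_mul, smul_eq_mul, mul_comm]
  congr 2
  ext l
  simp [Pi.single_apply, eq_comm]

lemma functional_col_ne_zero {G : Matrix (Fin k) (Fin n) F} (hG : LinearIndependent F G.row)
    {f : Dual F (Fin k → F)} (hf : f ≠ 0) : (fun j => f (G.col j)) ≠ 0 := by
  rw [functional_col_eq]
  intro h0
  have h1 := Fintype.linearIndependent_iff.mp hG _ h0
  exact hf ((Pi.basisFun F (Fin k)).ext fun i => by simpa using h1 i)

lemma functional_col_mem_span (G : Matrix (Fin k) (Fin n) F) (f : Dual F (Fin k → F)) :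
    (fun j => f (G.col j)) ∈ Submodule.span F (Set.range G.row) := by
  rw [functional_col_eq]
  exact Submodule.sum_mem _ fun i _ => Submodule.smul_mem _ _ (Submodule.subset_span ⟨i, rfl⟩)

lemma zeroCount_add_hammingNorm [DecidableEq F] (G : Matrix (Fin k) (Fin n) F)
    (f : Dual F (Fin k → F)) :
    zeroCount (fun j => Dual.eval F (Fin k → F) (G.col j)) f +
      hammingNorm (fun j => f (G.col j)) = n := by
  have h1 := Finset.card_filter_add_card_filter_not (s := (Finset.univ : Finset (Fin n)))
    (fun j => f (G.col j) = 0)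
  rw [Finset.card_univ, Fintype.card_fin] at h1
  refine Eq.trans ?_ h1
  rw [zeroCount, hammingNorm]
  congr!

end Code

end HypercylinderCode

theorem mainTheorem2 {F : Type*} [Field F] [Fintype F] [DecidableEq F]
    (q r t n : ℕ) (hq : Fintype.card F = q) (hq4 : 4 ≤ q) (hr : 3 ≤ r)
    (ht : 2 * q ^ (r - 3) < t) (ht' : t ≤ q ^ (r - 2) + q - 1)
    (hn : n = q ^ (r - 1) + q ^ (r - 2) + t)
    (C : Submodule F (Fin n → F)) (hdim : Module.finrank F C = r + 1)
    (hproj : HypercylinderCode.IsProjectiveCode C)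
    (hwt : ∀ c ∈ C, c ≠ 0 →
      hammingNorm c = q ^ (r - 1) ∨
      hammingNorm c = q ^ (r - 1) + t - 2 * q ^ (r - 3) ∨
      hammingNorm c = q ^ (r - 1) + q ^ (r - 2) + t) :
    Even q ∧ t = q ^ (r - 2) ∧ HypercylinderCode.IsHypercylinderCode r C := by
  classical
  obtain ⟨k, G, ⟨hGi, hGs⟩, hG⟩ := hproj
  obtain ⟨m, rfl⟩ : ∃ m, r = m + 3 := ⟨r - 3, by omega⟩
  obtain rfl : k = m + 3 + 1 := by
    rw [← hdim, ← hGs, finrank_span_eq_card hGi, Fintype.card_fin]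
  rw [show m + 3 - 3 = m from rfl] at ht hwt
  rw [show m + 3 - 2 = m + 1 from rfl] at ht' hwt hn ⊢
  rw [show m + 3 - 1 = m + 2 from rfl] at hwt hn
  obtain ⟨s, rfl⟩ : ∃ s, t = 2 * q ^ m + s := ⟨t - 2 * q ^ m, by omega⟩
  have hn2 : 1 < n := by
    have : 0 < q ^ (m + 2) := by positivity
    have : 0 < q ^ (m + 1) := by positivity
    omega
  -- A zero column contradicts projectivity only when there is another column for it to be a
  -- multiple of.
  have : Nontrivial (Fin n) := Fin.nontrivial_iff_two_le.mpr hn2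
  have hcol : ∀ j, G.col j ≠ 0 := by
    intro j hj
    obtain ⟨i, hi⟩ := exists_ne j
    exact hG j i hi.symm 0 (by rw [hj, zero_smul])
  have hfin : Finite (Module.Dual F (Fin (m + 3 + 1) → F)) := Module.finite_of_finite F
  have : Fintype (Module.Dual F (Fin (m + 3 + 1) → F)) := Fintype.ofFinite _
  have h : HypercylinderCode.IsThreeCharacter
      (fun j => Module.Dual.eval F (Fin (m + 3 + 1) → F) (G.col j)) q m s := by
    refine ⟨hq, hq4, ?_, ?_, by omega, by omega, fun f hf => ?_, fun j hj => hcol j ?_,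
      fun i j hij => ?_⟩
    · rw [Subspace.dual_finrank_eq, Module.finrank_fin_fun]
    · rw [Fintype.card_fin, hn, add_assoc (q ^ (m + 2) + q ^ (m + 1))]
    -- Subtracting the three weights from n gives the three levels.
    · have h1 := HypercylinderCode.zeroCount_add_hammingNorm G f
      have h2 := hwt _ (hGs ▸ HypercylinderCode.functional_col_mem_span G f)
        (HypercylinderCode.functional_col_ne_zero hGi hf)
      omega
    · exact (Module.forall_dual_apply_eq_zero_iff F _).mp fun f => LinearMap.congr_fun hj f
    · by_contra hne
      by_cases hmem : G.col j ∈ Submodule.span F {G.col i}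
      · obtain ⟨a, ha⟩ := Submodule.mem_span_singleton.mp hmem
        exact hG j i (Ne.symm hne) a ha.symm
      · obtain ⟨f, hf, hle⟩ := Submodule.exists_le_ker_of_notMem hmem
        exact hf (hij (hle (Submodule.mem_span_singleton_self _)))
  obtain ⟨hev, hs, π, σ, H, hπσ, hπ, hH, hS⟩ := h.exists_cone
  refine ⟨hev, hs, _, ⟨π, σ, H, hπσ, by omega, hH, rfl⟩, G, hcol, ?_, hGs.symm⟩
  rw [← hS]
  refine ⟨fun j _ => ⟨j, rfl⟩, fun i _ j _ hij => ?_, fun Q hQ => ?_⟩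
  · obtain ⟨a, ha⟩ := (Projectivization.mk_eq_mk_iff' F _ _ _ _).mp hij
    exact (h.eq_of_smul_eq ha.symm).symm
  · obtain ⟨j, rfl⟩ := hQ
    exact ⟨j, Set.mem_univ _, rfl⟩
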